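/- **Setting.** Let $\mathcal A, B$ be unital complex algebras, $\iota: B\to\mathcal A$ a unital algebra homomorphism, through which $B$ acts on $\mathcal A$ from the left and from the right, and let $\varphi,\psi:\mathcal A\to B$ be two conditional expectations, i.e. unital $B$-bimodule maps. For $x\in\mathcal A$ let $B\langle x\rangle$ be the algebra generated by $\iota(B)$ and $x$. Two elements $a,b\in\mathcal A$ are *conditionally free* if for all $n\ge 1$ and all $p_1,\dots,p_n$, each in $B\langle a\rangle$ or in $B\langle b\rangle$ with neighbours chosen from different algebras, and with $\psi(p_j)=0$ for all $j$, $$\psi(p_1\cdots p_n)=0 ,\qquad \varphi(p_1\cdots p_n)=\varphi(p_1)\cdots\varphi(p_n).$$ **Series.** We consider formal series $\alpha=\sum_{n\ge0}\alpha^{(n)}$ of $\mathbb C$-multilinear maps $\alpha^{(n)}:B^n\to B$, with the Cauchy product $(\alpha\beta)^{(n)}(b_1,\dots,b_n)=\sum_{k}\alpha^{(k)}(b_1,\dots,b_k)\,\beta^{(n-k)}(b_{k+1},\dots,b_n)$ (unit $1$, inverse $\alpha^{-1}$ if $\alpha^{(0)}=1$) and the composition $(\alpha\circ\beta)^{(n)}=\sum_{q_1+\dots+q_k=n,\;q_i\ge1}\alpha^{(k)}\circ(\beta^{(q_1)}\otimes\cdots\otimes\beta^{(q_k)})$,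 with $(\alpha\circ\beta)^{(0)}=\alpha^{(0)}$. Let $I$ be the series whose only non-zero term is $I^{(1)}=\mathrm{id}_B$. Put $$A\cdot_{\lambda}X=A\circ(IX),\qquad A\cdot_\rho X=A\circ(XI),\qquad A\star_\lambda X = X\,(A\cdot_\lambda X).$$ The series starting with $1$ form a group for $\star_\lambda$; write $g^{-1^{\star_\lambda}}$ for the inverse. **Transforms.** Let $\kappa_n,\kappa^c_n:\mathcal A^n\to B$ be the $B$-valued free cumulants of $\psi$ and the $B$-valued conditionally free cumulants of $(\varphi,\psi)$, defined recursively by (the image under $\iota$ being understood) $$\psi(a_1\cdots a_n)=\sum_{1=v_1<\dots<v_k\le n}\kappa_k\big(a_{v_1}\psi(w_1),\dots,a_{v_k}\psi(w_k)\big),$$ $$\varphi(a_1\cdots a_n)=\sum_{1=v_1<\dots<v_k\le n}\kappa^c_k\big(a_{v_1}\psi(w_1),\dots,a_{v_{k-1}}\psi(w_{k-1}),a_{v_k}\varphi(w_k)\big),$$ where $w_j=a_{v_j+1}\cdots a_{v_{j+1}-1}$ (with $v_{k+1}=n+1$). For $x\in\mathcal A$ with $\varphi(x)=\psi(x)=1$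 let $K_x,K_x^c$ be the series with $K_x^{(n)}(b_1,\dots,b_n)=\kappa_{n+1}(xb_1,\dots,xb_n,x)$ and $K_x^{c\,(n)}(b_1,\dots,b_n)=\kappa^c_{n+1}(xb_1,\dots,xb_n,x)$; let $T_x,T_x^c$ be the unique solutions of $K_x=T_x\cdot_\lambda K_x$ and $K_x^c=T_x^c\cdot_\lambda K_x$; and set, with $E=I(1-I)^{-1}$, $$\Sigma_x=T_x^{-1}\circ E,\qquad H_x=\Sigma_x^{-1^{\star_\lambda}},\qquad H_x^c=(T_x^c\circ E)\cdot_\lambda H_x .$$ For such $a,b$ the subordination series are $$H_{a\vdash b}=\big(\Sigma_a\cdot_\rho \Sigma_b^{-1^{\star_\lambda}}\big)^{-1^{\star_\lambda}},\qquad H_{a\dashv b}=H_b\cdot_\lambda H_{a\vdash b}.$$ **Theorem.** Let $a,b\in\mathcal A$ be conditionally free with $\varphi(a)=\varphi(b)=1=\psi(a)=\psi(b)$. Then $$H^c_{ab}=\big(H^c_a\cdot_\rho H_{a\dashv b}\big)\,\big(H^c_b\cdot_\lambda H_{a\vdash b}\big),$$ and $$H_{a\dashv b}=H_b\cdot_\lambda\big(H_a\cdot_\rho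 H_{a\dashv b}\big),\qquad H_{a\vdash b}=H_a\cdot_\rho\big(H_b\cdot_\lambda H_{a\vdash b}\big).$$ -/

import Mathlib

noncomputable section

namespace CondFree

/-! ## Formal series of multilinear maps -/

/-- Formal series `α = ∑ₙ α⁽ⁿ⁾` with `α⁽ⁿ⁾ : Eⁿ → F` a `ℂ`-multilinear map (`α⁽⁰⁾` is an
element of `F`). -/
def MSeries (E F : Type*) [AddCommGroup E] [Module ℂ E] [AddCommGroup F] [Module ℂ F] :=
  ∀ n : ℕ, MultilinearMap ℂ (fun _ : Fin n => E) F

section Series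

variable {E F G : Type*} [AddCommGroup E] [Module ℂ E] [AddCommGroup F] [Module ℂ F]
  [AddCommGroup G] [Module ℂ G]

instance : AddCommGroup (MSeries E F) :=
  inferInstanceAs (AddCommGroup (∀ n : ℕ, MultilinearMap ℂ (fun _ : Fin n => E) F))

/-- The identity series `I`: its only non-zero coefficient is `I⁽¹⁾ = id`. -/
def ident (E : Type*) [AddCommGroup E] [Module ℂ E] : MSeries E E
  | 0 => 0
  | 1 => MultilinearMap.ofSubsingleton ℂ E E 0 LinearMap.id
  | _ + 2 => 0

/-- For a composition `c = (q₁, …, q_k)` of `n`, a `k`-linear map `f` and series `β₁, …, β_k`: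
the `n`-linear map `f ∘ (β₁^(q₁) ⊗ ⋯ ⊗ β_k^(q_k))`. -/
def plugBlocks {n : ℕ} (c : Composition n) (f : MultilinearMap ℂ (fun _ : Fin c.length => F) G)
    (β : Fin c.length → MSeries E F) : MultilinearMap ℂ (fun _ : Fin n => E) G :=
  have key : ∀ (j : Fin n) (v : Fin n → E) (z : E),
      (fun i => β i (c.blocksFun i) (Function.update v j z ∘ c.embedding i)) =
        Function.update (fun i => β i (c.blocksFun i) (v ∘ c.embedding i)) (c.index j)
          (β (c.index j) (c.blocksFun (c.index j))
            (Function.update (v ∘ c.embedding (c.index j)) (c.invEmbedding j) z)) := by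
    intro j v z
    ext k
    by_cases h : k = c.index j
    · subst h
      simp only [Function.update_self]
      congr 1
      have := Function.update_comp_eq_of_injective v (c.embedding (c.index j)).injective
        (c.invEmbedding j) z
      rw [c.embedding_comp_inv j] at this
      exact this
    · simp only [h, Function.update_of_ne, Ne, not_false_iff]
      congr 1
      apply Function.update_comp_eq_of_notMem_range
      rwa [c.mem_range_embedding_iff']
  MultilinearMap.mk' (fun v => f (fun i => β i (c.blocksFun i) (v ∘ c.embedding i)))
    (fun v i x y => by simp only [key, MultilinearMap.map_update_add])
    (fun v i a x => by simp only [key, MultilinearMap.map_update_smul])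

@[simp]
theorem plugBlocks_apply {n : ℕ} (c : Composition n)
    (f : MultilinearMap ℂ (fun _ : Fin c.length => F) G) (β : Fin c.length → MSeries E F)
    (v : Fin n → E) :
    plugBlocks c f β v = f (fun i => β i (c.blocksFun i) (v ∘ c.embedding i)) :=
  rfl

/-- The composition product
`(α ∘ β)⁽ⁿ⁾ = ∑_{q₁ + ⋯ + q_k = n, qᵢ ≥ 1} α^(k) ∘ (β^(q₁) ⊗ ⋯ ⊗ β^(q_k))`.
In degree zero, `(α ∘ β)⁽⁰⁾ = α⁽⁰⁾`, so that `(1 + α) ∘ β = 1 + α ∘ β`. -/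
def comp (α : MSeries F G) (β : MSeries E F) : MSeries E G :=
  fun n => ∑ c : Composition n, plugBlocks c (α c.length) (fun _ => β)

/-- For `β` with `β⁽⁰⁾ = 0` and `β⁽¹⁾ = id`: the series `N ∘ β^{-1}`, where `β^{-1}` is the inverse
for composition, i.e. the unique `α` with `α ∘ β = N`. In degree `n` this equation reads
`α⁽ⁿ⁾ + ∑_{k < n} α^(k) ∘ (⋯) = N⁽ⁿ⁾`, which is solved recursively. -/
def compDiv (N : MSeries E G) (β : MSeries E E) : MSeries E G
  | n => N n - ∑ c : {c : Composition n // c.length < n},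
      have := c.2
      plugBlocks c.1 (compDiv N β c.1.length) (fun _ => β)

/-- `compDiv N β` solves `α ∘ β = N`. -/
theorem compDiv_comp (N : MSeries E G) (β : MSeries E E) (hβ : ∀ v, β 1 v = v 0) :
    comp (compDiv N β) β = N := by
  funext n
  have hs : ∀ f : Composition n → MultilinearMap ℂ (fun _ : Fin n => E) G,
      ∑ c, f c = f (Composition.ones n) + ∑ c : {c : Composition n // c.length < n}, f c.1 := by
    intro f
    classical
    rw [← Finset.add_sum_erase _ _ (Finset.mem_univ (Composition.ones n))]
    congr 1
    refine Finset.sum_subtype _ (fun c => ?_) f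
    rw [Finset.mem_erase, Ne, Composition.eq_ones_iff_le_length]
    simp
  have h1 : plugBlocks (Composition.ones n) (compDiv N β (Composition.ones n).length)
      (fun _ => β) = compDiv N β n := by
    ext v
    rw [plugBlocks_apply]
    have hb : ∀ i : Fin (Composition.ones n).length,
        β ((Composition.ones n).blocksFun i) (v ∘ (Composition.ones n).embedding i) =
          v (Fin.cast (Composition.ones_length n) i) := by
      intro i
      have gen : ∀ (m : ℕ) (hm : m = 1) (w : Fin m → E), β m w = w ⟨0, by omega⟩ := by
        rintro m rfl w
        exact hβ w
      rw [gen _ (Composition.ones_blocksFun n i)]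
      simp only [Function.comp_apply]
      congr 1
      ext
      rw [Composition.ones_embedding]
      rfl
    simp only [hb]
    have gen : ∀ (m : ℕ) (hm : m = n),
        compDiv N β m (fun i => v (Fin.cast hm i)) = compDiv N β n v := by
      rintro m rfl
      rfl
    exact gen _ _
  rw [comp, hs, h1]
  conv_lhs => enter [1]; rw [compDiv]
  exact sub_add_cancel _ _

end Series

section Cauchy

variable {E R : Type*} [AddCommGroup E] [Module ℂ E] [Ring R] [Algebra ℂ R]

/-- The series `1`: its only non-zero coefficient is `1⁽⁰⁾ = 1`. -/
instance : One (MSeries E R) where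
  one
    | 0 => MultilinearMap.constOfIsEmpty ℂ _ 1
    | _ + 1 => 0

/-- `(v₁, …, vₙ) ↦ f(v₁, …, v_k) g(v_{k+1}, …, vₙ)`. -/
def mulAt {n k : ℕ} (hk : k ≤ n) (f : MultilinearMap ℂ (fun _ : Fin k => E) R)
    (g : MultilinearMap ℂ (fun _ : Fin (n - k) => E) R) :
    MultilinearMap ℂ (fun _ : Fin n => E) R :=
  have key : ∀ (j : Fin n) (v : Fin n → E), ∃ f' g' : E →ₗ[ℂ] R, ∃ p q : R,
      ∀ z, f (fun i : Fin k => Function.update v j z ⟨i, by omega⟩) *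
        g (fun i : Fin (n - k) => Function.update v j z ⟨k + i, by omega⟩) =
        f' z * q + p * g' z := by
    intro j v
    by_cases h : (j : ℕ) < k
    · refine ⟨f.toLinearMap (fun i : Fin k => v ⟨i, by omega⟩) ⟨j, h⟩, 0, 0,
        g (fun i : Fin (n - k) => v ⟨k + i, by omega⟩), fun z => ?_⟩
      have e1 : (fun i : Fin k => Function.update v j z ⟨i, by omega⟩) =
          Function.update (fun i : Fin k => v ⟨i, by omega⟩) ⟨j, h⟩ z := by
        ext i
        simp only [Function.update_apply, Fin.ext_iff]
      have e2 : (fun i : Fin (n - k) => Function.update v j z ⟨k + i, by omega⟩) =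
          (fun i : Fin (n - k) => v ⟨k + i, by omega⟩) := by
        ext i
        rw [Function.update_of_ne]
        simp only [Ne, Fin.ext_iff]
        omega
      rw [e1, e2]
      simp
    · refine ⟨0, g.toLinearMap (fun i : Fin (n - k) => v ⟨k + i, by omega⟩) ⟨j - k, by omega⟩,
        f (fun i : Fin k => v ⟨i, by omega⟩), 0, fun z => ?_⟩
      have e1 : (fun i : Fin k => Function.update v j z ⟨i, by omega⟩) =
          (fun i : Fin k => v ⟨i, by omega⟩) := by
        ext i
        rw [Function.update_of_ne]
        simp only [Ne, Fin.ext_iff]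
        omega
      have e2 : (fun i : Fin (n - k) => Function.update v j z ⟨k + i, by omega⟩) =
          Function.update (fun i : Fin (n - k) => v ⟨k + i, by omega⟩) ⟨j - k, by omega⟩ z := by
        ext i
        simp only [Function.update_apply, Fin.ext_iff]
        congr 1
        apply propext
        omega
      rw [e1, e2]
      simp
  MultilinearMap.mk'
    (fun v => f (fun i => v ⟨i, by omega⟩) * g (fun i => v ⟨k + i, by omega⟩))
    (fun v i x y => by
      obtain ⟨f', g', p, q, h⟩ := key i v
      simp only [h, map_add, add_mul, mul_add]
      abel)
    (fun v i a x => by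
      obtain ⟨f', g', p, q, h⟩ := key i v
      simp only [h, map_smul, smul_mul_assoc, mul_smul_comm, smul_add])

@[simp]
theorem mulAt_apply {n k : ℕ} (hk : k ≤ n) (f : MultilinearMap ℂ (fun _ : Fin k => E) R)
    (g : MultilinearMap ℂ (fun _ : Fin (n - k) => E) R) (v : Fin n → E) :
    mulAt hk f g v = f (fun i => v ⟨i, by omega⟩) * g (fun i => v ⟨k + i, by omega⟩) :=
  rfl

/-- The Cauchy product
`(α β)⁽ⁿ⁾(v₁, …, vₙ) = ∑_{k = 0}^n α^(k)(v₁, …, v_k) β^(n-k)(v_{k+1}, …, vₙ)`. -/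
instance : Mul (MSeries E R) where
  mul α β := fun n => ∑ k : Fin (n + 1), mulAt (Nat.lt_succ_iff.mp k.2) (α k) (β (n - k))

/-- The inverse for the Cauchy product of a series `α` with `α⁽⁰⁾ = 1`; in degree `n` the equation
`α X = 1` reads `X⁽ⁿ⁾ + ∑_{k = 1}^n α^(k) X^(n-k) = 1⁽ⁿ⁾`, which is solved recursively. -/
def cinv (α : MSeries E R) : MSeries E R
  | n => (1 : MSeries E R) n -
      ∑ k : Fin n, mulAt (k := k + 1) (by omega) (α (k + 1)) (cinv α (n - (k + 1)))
termination_by n => n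
decreasing_by have := k.2; omega

/-- `cinv α` solves `α X = 1`. -/
theorem mul_cinv (α : MSeries E R) (hα : ∀ v, α 0 v = 1) : α * cinv α = 1 := by
  funext n
  change ∑ k : Fin (n + 1), mulAt (Nat.lt_succ_iff.mp k.2) (α k) (cinv α (n - k)) = _
  rw [Fin.sum_univ_succ]
  have h0 : mulAt (Nat.lt_succ_iff.mp (0 : Fin (n + 1)).2) (α (0 : Fin (n + 1)))
      (cinv α (n - (0 : Fin (n + 1)))) = cinv α n := by
    ext v
    rw [mulAt_apply]
    have : α ((0 : Fin (n + 1)) : ℕ) (fun i => v ⟨i, by have := i.2; simp at this⟩) = 1 := hα _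
    rw [this, one_mul]
    change cinv α n _ = _
    congr 1
    ext i
    congr 1
    ext
    simp
  rw [h0]
  conv_lhs => enter [1]; rw [cinv]
  exact sub_add_cancel _ _

end Cauchy

/-! ## The actions and the product attached to the translations by the unit -/

section Actions

variable {B : Type*} [Ring B] [Algebra ℂ B]

/-- `A ·_λ X = A ∘ (I X)`, the action through the left translation `λ(X) = I X`. -/
def actLambda (A X : MSeries B B) : MSeries B B := comp A (ident B * X)

/-- `A ·_ρ X = A ∘ (X I)`, the action through the right translation `ρ(X) = X I`. -/
def actRho (A X : MSeries B B) : MSeries B B := comp A (X * ident B)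

/-- The group product `A ⋆_λ X = X (A ·_λ X)`, for which `λ(A ⋆_λ X) = λ(A) ∘ λ(X)`. -/
def starLambda (A X : MSeries B B) : MSeries B B := X * actLambda A X

/-- The inverse `g^{-1} ∘ λ(g)^{-1}` of `g` for the product `⋆_λ` (`g` starting with `1`). -/
def starLambdaInv (g : MSeries B B) : MSeries B B := compDiv (cinv g) (ident B * g)

theorem starLambdaInv_starLambda (g : MSeries B B) (hg : ∀ v, g 0 v = 1) :
    starLambda (starLambdaInv g) g = 1 := by
  rw [starLambda, actLambda, starLambdaInv, compDiv_comp, mul_cinv g hg]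
  intro v
  change (∑ k : Fin 2, mulAt (Nat.lt_succ_iff.mp k.2) (ident B k) (g (1 - k))) v = _
  rw [Fin.sum_univ_two, add_apply, mulAt_apply, mulAt_apply]
  have h0 : ∀ w, ident B ((0 : Fin 2) : ℕ) w = 0 := fun w => rfl
  have h1 : ∀ w, ident B ((1 : Fin 2) : ℕ) w = w (0 : Fin 1) := fun w => rfl
  have h2 : ∀ w, g (1 - ((1 : Fin 2) : ℕ)) w = 1 := fun w => hg w
  rw [h0, h1, h2, zero_mul, zero_add, mul_one]

/-- The series `I / (1 - I) = I + I² + I³ + ⋯`. -/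
def geomSeries (B : Type*) [Ring B] [Algebra ℂ B] : MSeries B B :=
  ident B * cinv (1 - ident B)

end Actions

/-! ## Operator-valued probability spaces, freeness and conditional freeness -/

section Probability

variable {A B : Type*} [Ring A] [Algebra ℂ A] [Ring B] [Algebra ℂ B]

/-- `B` acts on `A` on the left and on the right through the unital homomorphism `ι`. A
conditional expectation is a unital `B`-bimodule map `A → B`. -/
structure IsCondExp (ι : B →ₐ[ℂ] A) (φ : A →ₗ[ℂ] B) : Prop where
  map_one : φ 1 = 1
  map_bimod : ∀ (b b' : B) (x : A), φ (ι b * x * ι b') = b * φ x * b'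

/-- The algebra generated by `x` and by (the image of) `B`. -/
def genAlg (ι : B →ₐ[ℂ] A) (x : A) : Subalgebra ℂ A := Algebra.adjoin ℂ (Set.range ι ∪ {x})

/-- `p₁, …, p_{n+1}` is an alternating `ψ`-centred tuple: `pⱼ` belongs to the algebra generated by
`B` and `a` (if `i j = true`) or by `B` and `b` (if `i j = false`), neighbours belong to different
algebras, and `ψ(pⱼ) = 0`. -/
structure IsAlternatingCentred (ι : B →ₐ[ℂ] A) (ψ : A →ₗ[ℂ] B) (a b : A) {n : ℕ}
    (i : Fin (n + 1) → Bool) (p : Fin (n + 1) → A) : Prop where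
  mem : ∀ j, p j ∈ genAlg ι (if i j then a else b)
  centred : ∀ j, ψ (p j) = 0
  alternating : ∀ j : Fin n, i j.castSucc ≠ i j.succ

/-- `a` and `b` are free with amalgamation over `B` with respect to `ψ`. -/
def IsFree (ι : B →ₐ[ℂ] A) (ψ : A →ₗ[ℂ] B) (a b : A) : Prop :=
  ∀ (n : ℕ) (i : Fin (n + 1) → Bool) (p : Fin (n + 1) → A),
    IsAlternatingCentred ι ψ a b i p → ψ (List.ofFn p).prod = 0

/-- `a` and `b` are conditionally free in `(A, φ, ψ, B)`: free with respect to `ψ`, and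
`φ(p₁ ⋯ pₙ) = φ(p₁) ⋯ φ(pₙ)` for alternating `ψ`-centred tuples. -/
structure IsCondFree (ι : B →ₐ[ℂ] A) (φ ψ : A →ₗ[ℂ] B) (a b : A) : Prop where
  free : IsFree ι ψ a b
  cond : ∀ (n : ℕ) (i : Fin (n + 1) → Bool) (p : Fin (n + 1) → A),
    IsAlternatingCentred ι ψ a b i p →
      φ (List.ofFn p).prod = (List.ofFn fun j => φ (p j)).prod

/-! ## Free and conditionally free cumulants -/

/-- The moments `(a₁, …, aₙ) ↦ φ(a₁ ⋯ aₙ)`. -/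
def moments {F : Type*} [AddCommGroup F] [Module ℂ F] (φ : A →ₗ[ℂ] F) : MSeries A F :=
  fun n => φ.compMultilinearMap (MultilinearMap.mkPiAlgebraFin ℂ n A)

/-- The series `(a₁, …, aₙ) ↦ a₁ ψ(a₂ ⋯ aₙ)`, with values in `A`. -/
def headMoments (ι : B →ₐ[ℂ] A) (ψ : A →ₗ[ℂ] B) : MSeries A A :=
  ident A * moments (ι.toLinearMap ∘ₗ ψ)

/-- The `B`-valued free cumulants `κₙ : Aⁿ → B`, given by the moment-cumulant formula
`ψ(a₁ ⋯ aₙ) = ∑_V κ_k(a_{v₁} ψ(⋯), a_{v₂} ψ(⋯), …, a_{v_k} ψ(⋯))`.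
The sum is over the subsets `V = {1 = v₁ < ⋯ < v_k}` of `{1, …, n}` (the block of `1` in a
non-crossing partition) and the dots stand for the products of the `aᵢ` in the gaps following
`v₁`, `v₂`, …, `v_k`; such a `V` is the same thing as a composition of `n`, with blocks starting
at the points of `V`. -/
def freeCumulants (ι : B →ₐ[ℂ] A) (ψ : A →ₗ[ℂ] B) : MSeries A B :=
  compDiv (moments ψ) (headMoments ι ψ)

/-- The `B`-valued conditionally free cumulants `κᶜₙ : Aⁿ → B`, given by
`φ(a₁ ⋯ aₙ) = ∑_V κᶜ_k(a_{v₁} ψ(⋯), …, a_{v_{k-1}} ψ(⋯), a_{v_k} φ(⋯))`,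
with the same notation as for the free cumulants: gaps enclosed by the block `V` are evaluated
with `ψ`, the part to the right of `V` with `φ`. -/
def condCumulants (ι : B →ₐ[ℂ] A) (φ ψ : A →ₗ[ℂ] B) : MSeries A B
  | n => moments φ n - ∑ c : {c : Composition n // c.length < n},
      have := c.2
      plugBlocks c.1 (condCumulants ι φ ψ c.1.length)
        (fun j => if (j : ℕ) + 1 = c.1.length then headMoments ι φ else headMoments ι ψ)

/-- For `κ` a family of multilinear maps on `A`: the series with coefficients
`(b₁, …, bₙ) ↦ κ_{n+1}(x b₁, …, x bₙ, x)`. -/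
def cumulantSeries (ι : B →ₐ[ℂ] A) (κ : MSeries A B) (x : A) : MSeries B B :=
  fun n => ((LinearMap.applyₗ x).compMultilinearMap (κ (n + 1)).curryRight).compLinearMap
    (fun _ => LinearMap.mulLeft ℂ x ∘ₗ ι.toLinearMap)

@[simp]
theorem cumulantSeries_apply (ι : B →ₐ[ℂ] A) (κ : MSeries A B) (x : A) (n : ℕ) (v : Fin n → B) :
    cumulantSeries ι κ x n v = κ (n + 1) (Fin.snoc (fun i => x * ι (v i)) x) :=
  rfl

/-- The free cumulant series `K_x` (it starts with `1` if `ψ(x) = 1`). -/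
def K (ι : B →ₐ[ℂ] A) (ψ : A →ₗ[ℂ] B) (x : A) : MSeries B B :=
  cumulantSeries ι (freeCumulants ι ψ) x

/-- The conditionally free cumulant series `Kᶜ_x` (it starts with `1` if `φ(x) = 1`). -/
def Kc (ι : B →ₐ[ℂ] A) (φ ψ : A →ₗ[ℂ] B) (x : A) : MSeries B B :=
  cumulantSeries ι (condCumulants ι φ ψ) x

/-! ## The transforms -/

/-- The `T`-transform: the solution `T_x` of `K_x = T_x ∘ (I K_x) = T_x ·_λ K_x`. -/
def T (ι : B →ₐ[ℂ] A) (ψ : A →ₗ[ℂ] B) (x : A) : MSeries B B :=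
  compDiv (K ι ψ x) (ident B * K ι ψ x)

/-- The conditional `T`-transform: the solution `Tᶜ_x` of `Kᶜ_x = Tᶜ_x ·_λ K_x`. -/
def Tc (ι : B →ₐ[ℂ] A) (φ ψ : A →ₗ[ℂ] B) (x : A) : MSeries B B :=
  compDiv (Kc ι φ ψ x) (ident B * K ι ψ x)

/-- `Σ_x = T_x^{-1} ∘ (I / (1 - I))`. -/
def Sig (ι : B →ₐ[ℂ] A) (ψ : A →ₗ[ℂ] B) (x : A) : MSeries B B :=
  comp (cinv (T ι ψ x)) (geomSeries B)

/-- The `H`-transform: the inverse of `Σ_x` for `⋆_λ`. -/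
def H (ι : B →ₐ[ℂ] A) (ψ : A →ₗ[ℂ] B) (x : A) : MSeries B B :=
  starLambdaInv (Sig ι ψ x)

/-- The conditional `H`-transform `Hᶜ_x = (Tᶜ_x ∘ (I / (1 - I))) ·_λ H_x`. -/
def Hc (ι : B →ₐ[ℂ] A) (φ ψ : A →ₗ[ℂ] B) (x : A) : MSeries B B :=
  actLambda (comp (Tc ι φ ψ x) (geomSeries B)) (H ι ψ x)

/-- The subordination series `H_{a ⊢ b}`: the inverse for `⋆_λ` of `Σ_a ·_ρ (Σ_b^{-1})`, where
`Σ_b^{-1}` is itself the inverse for `⋆_λ`. -/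
def HrightTack (ι : B →ₐ[ℂ] A) (ψ : A →ₗ[ℂ] B) (a b : A) : MSeries B B :=
  starLambdaInv (actRho (Sig ι ψ a) (starLambdaInv (Sig ι ψ b)))

/-- The subordination series `H_{a ⊣ b} = H_b ·_λ H_{a ⊢ b}`. -/
def HleftTack (ι : B →ₐ[ℂ] A) (ψ : A →ₗ[ℂ] B) (a b : A) : MSeries B B :=
  actLambda (H ι ψ b) (HrightTack ι ψ a b)

end Probability

end CondFree

end

/-! Everything reduces to geometric series. Write `R_x = (1 - I x)⁻¹`, a series over `A`. For words
`x b₁, …, x bₙ, x` the moment-cumulant formulas sum up to `φ(x R_x) = (Kᶜ_x ∘ (ψ(R_x) I)) φ(R_x)`,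
and likewise for `ψ` and `K_x` (`moments_eq_comp_cumulantSeries`). The first factors are Boolean
cumulant series, and they are exactly the transforms `H_x` and `Hᶜ_x` (`H_eq_boolSeries`,
`Hc_eq_boolSeries`). Hence `ψ(R_x) = (1 - I H_x)⁻¹` and `φ(R_x) = (1 - I Hᶜ_x)⁻¹`, and for `ab` it
is enough to compute `φ(R_{ab})`.

Put `F = H_{a⊣b}` and `G = H_{a⊢b}`. A computation with inverses for composition gives `G = H_a ·_ρ
F` (`actRho_starLambdaInv`), while `F = H_b ·_λ G` by definition. With `S = (1 - F I a)⁻¹` and `T =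
(1 - I G b)⁻¹`, these two equations say precisely that `p = I (a S (1 - F I G) - G)` and `q = (b -
F) T` are `ψ`-centred. A purely algebraic identity (`subordination_factorization`) writes `(1 - I a
b)⁻¹` as an expression in `p`, `q` and series over `B`, whose expansion contains only alternating
products of centred series.

Conditional freeness, extended to series and to infinite sums (`IsCondFree.map_mul_cinv_mul`),
therefore lets `φ` replace `p`, `q` by `φ(p)`, `φ(q)`. These are given by the same formulas as `p`,
`q`, with `a`, `b` replaced by `Gᶜ = Hᶜ_a ·_ρ F`, `Fᶜ = Hᶜ_b ·_λ G` and with `S`, `T` replaced by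
`φ(S)`, `φ(T)`. The same identity, now over `B`, gives `φ(R_{ab}) = (1 - I Gᶜ Fᶜ)⁻¹`, so `Hᶜ_{ab} =
Gᶜ Fᶜ`. -/

noncomputable section

namespace CondFree

namespace MSeries

/-! ### Series as functions on words. -/

section Basic

variable {E F G : Type*} [AddCommGroup E] [Module ℂ E] [AddCommGroup F] [Module ℂ F]
  [AddCommGroup G] [Module ℂ G]

/-- The value of a series on a word `[v₁, …, vₙ]`, i.e. `α⁽ⁿ⁾(v₁, …, vₙ)`. -/
def ev (α : MSeries E G) (l : List E) : G := α l.length l.get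

/-- The series with coefficients `(v₁, …, vₙ) ↦ α⁽ⁿ⁺¹⁾(x, v₁, …, vₙ)`. -/
def head (α : MSeries E G) (x : E) : MSeries E G := fun n => (α (n + 1)).curryLeft x

theorem coeff_congr (α : MSeries E G) {m n : ℕ} (h : m = n) {v : Fin m → E} {w : Fin n → E}
    (hvw : ∀ i (hm : i < m) (hn : i < n), v ⟨i, hm⟩ = w ⟨i, hn⟩) : α m v = α n w := by
  subst h
  congr 1
  ext ⟨i, hi⟩
  exact hvw i hi hi

theorem coeff_eq_ev (α : MSeries E G) {n : ℕ} (v : Fin n → E) : α n v = ev α (List.ofFn v) :=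
  coeff_congr α (by simp) (by simp)

theorem ext_ev {α β : MSeries E G} (h : ∀ l, ev α l = ev β l) : α = β := by
  funext n
  ext v
  rw [coeff_eq_ev, coeff_eq_ev, h]

theorem ev_nil (α : MSeries E G) (v : Fin 0 → E) : ev α [] = α 0 v :=
  coeff_congr α rfl (by simp)

theorem ev_cons (α : MSeries E G) (x : E) (l : List E) : ev α (x :: l) = ev (head α x) l := by
  refine coeff_congr α rfl fun i hm hn => ?_
  cases i <;> rfl

@[simp]
theorem ev_add (α β : MSeries E G) (l : List E) : ev (α + β) l = ev α l + ev β l := rfl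

@[simp]
theorem ev_sub (α β : MSeries E G) (l : List E) : ev (α - β) l = ev α l - ev β l := rfl

@[simp]
theorem ev_zero (l : List E) : ev (0 : MSeries E G) l = 0 := rfl

theorem ev_ident_nil : ev (ident E) [] = 0 := rfl

theorem ev_ident_singleton (x : E) : ev (ident E) [x] = x := rfl

theorem ev_ident_cons_cons (x y : E) (l : List E) : ev (ident E) (x :: y :: l) = 0 := rfl

/-- The series obtained by applying a linear map to all coefficients. -/
def map (f : F →ₗ[ℂ] G) : MSeries E F →+ MSeries E G where
  toFun α n := f.compMultilinearMap (α n)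
  map_zero' := ext_ev fun _ => map_zero f
  map_add' _ _ := ext_ev fun _ => map_add f _ _

@[simp]
theorem ev_map (f : F →ₗ[ℂ] G) (α : MSeries E F) (l : List E) : ev (map f α) l = f (ev α l) := rfl

theorem head_map (f : F →ₗ[ℂ] G) (α : MSeries E F) (x : E) :
    head (map f α) x = map f (head α x) := rfl

/-- The series whose only non-zero coefficient is the one of degree zero. -/
def const (E : Type*) {G : Type*} [AddCommGroup E] [Module ℂ E] [AddCommGroup G] [Module ℂ G]
    (r : G) : MSeries E G
  | 0 => MultilinearMap.constOfIsEmpty ℂ _ r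
  | _ + 1 => 0

theorem ev_const_nil (r : G) : ev (const E r) [] = r := rfl

theorem ev_const_cons (r : G) (x : E) (l : List E) : ev (const E r) (x :: l) = 0 := rfl

theorem head_const (r : G) (x : E) : head (const E r) x = 0 := ext_ev fun _ => rfl

theorem map_const (f : F →ₗ[ℂ] G) (r : F) : map f (const E r) = const E (f r) := by
  refine ext_ev fun l => ?_
  cases l with
  | nil => rfl
  | cons x l => rw [ev_map, ev_const_cons, ev_const_cons, map_zero]

end Basic

/-! ### The ring of series under the Cauchy product. -/

section Ring

variable {E R : Type*} [AddCommGroup E] [Module ℂ E] [Ring R] [Algebra ℂ R]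

theorem ev_one_nil : ev (1 : MSeries E R) [] = 1 := rfl

theorem ev_one_cons (x : E) (l : List E) : ev (1 : MSeries E R) (x :: l) = 0 := rfl

theorem head_one (x : E) : head (1 : MSeries E R) x = 0 := ext_ev fun _ => rfl

theorem coeff_mul (α β : MSeries E R) (n : ℕ) (v : Fin n → E) :
    (α * β) n v = ∑ k : Fin (n + 1), α k (fun i => v ⟨i, by omega⟩) *
      β (n - k) (fun i => v ⟨k + i, by omega⟩) := by
  change (∑ k : Fin (n + 1), mulAt (Nat.lt_succ_iff.mp k.2) (α k) (β (n - k))) v = _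
  rw [sum_apply]
  rfl

theorem ev_mul_nil (α β : MSeries E R) : ev (α * β) [] = ev α [] * ev β [] := by
  change (α * β) 0 _ = _
  rw [coeff_mul, Fin.sum_univ_one]
  exact congr_arg₂ _ (coeff_congr α rfl (by simp)) (coeff_congr β rfl (by simp))

/-- Either the left factor takes no letter, or it takes `x` and continues as `head α x`. This
recursion replaces the sums over `Fin` in all later inductions on words. -/
theorem ev_mul_cons (α β : MSeries E R) (x : E) (l : List E) :
    ev (α * β) (x :: l) = ev α [] * ev β (x :: l) + ev (head α x * β) l := by
  change (α * β) (l.length + 1) _ = _ + (head α x * β) l.length _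
  rw [coeff_mul, coeff_mul, Fin.sum_univ_succ]
  refine congr_arg₂ _ (congr_arg₂ _ (coeff_congr α rfl (by simp)) (coeff_congr β rfl ?_))
    (Finset.sum_congr rfl fun k _ => congr_arg₂ _ ?_ (coeff_congr β (by simp) ?_))
  · intro i hm hn
    simp
  · refine coeff_congr α rfl fun i hm hn => ?_
    cases i <;> rfl
  · intro i hm hn
    simp only [Fin.val_succ, List.get_eq_getElem]
    simp only [Nat.add_right_comm _ 1, List.getElem_cons_succ]

/-- Series of order at least `m` form a left ideal; this is what makes left multiplication
continuous when passing to limits of series. -/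
theorem mul_eq_zero_ev {γ : MSeries E R} {m : ℕ} (h : ∀ l, l.length < m → ev γ l = 0)
    (δ : MSeries E R) : ∀ l, l.length < m → ev (δ * γ) l = 0 := by
  intro l
  induction l generalizing δ with
  | nil => intro hl; rw [ev_mul_nil, h _ hl, mul_zero]
  | cons x l ih =>
    intro hl
    rw [ev_mul_cons, h _ hl, mul_zero, zero_add]
    exact ih _ (by simp at hl; omega)

instance : Ring (MSeries E R) :=
  { (inferInstance : AddCommGroup (MSeries E R)),
    (inferInstance : Mul (MSeries E R)),
    (inferInstance : One (MSeries E R)) with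
    left_distrib := fun α β γ => by
      refine ext_ev fun l => ?_
      induction l generalizing α with
      | nil => simp [ev_mul_nil, mul_add]
      | cons x l ih =>
        have := ih (head α x)
        simp only [ev_add] at this
        simp only [ev_add, ev_mul_cons, this, mul_add]
        abel
    right_distrib := fun α β γ => by
      refine ext_ev fun l => ?_
      induction l generalizing α β with
      | nil => simp [ev_mul_nil, add_mul]
      | cons x l ih =>
        have h : ev (head (α + β) x * γ) l = _ := ih (head α x) (head β x)
        simp only [ev_add] at h
        simp only [ev_add, ev_mul_cons, h, add_mul]
        abel
    zero_mul := fun γ => by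
      refine ext_ev fun l => ?_
      induction l with
      | nil => simp [ev_mul_nil]
      | cons x l ih =>
        have h : ev (head (0 : MSeries E R) x * γ) l = _ := ih
        simp [ev_mul_cons, h]
    mul_zero := fun γ => by
      refine ext_ev fun l => ?_
      induction l generalizing γ with
      | nil => simp [ev_mul_nil]
      | cons x l ih => simpa [ev_mul_cons] using ih _
    one_mul := fun γ => by
      have h0 : ∀ l : List E, ev ((0 : MSeries E R) * γ) l = 0 := fun l => by
        induction l with
        | nil => simp [ev_mul_nil]
        | cons x l ih =>
          have h : ev (head (0 : MSeries E R) x * γ) l = _ := ih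
          simp [ev_mul_cons, h]
      refine ext_ev fun l => ?_
      cases l with
      | nil => rw [ev_mul_nil, ev_one_nil, one_mul]
      | cons x l => rw [ev_mul_cons, ev_one_nil, one_mul, head_one, h0, add_zero]
    mul_one := fun γ => by
      refine ext_ev fun l => ?_
      induction l generalizing γ with
      | nil => rw [ev_mul_nil, ev_one_nil, mul_one]
      | cons x l ih => rw [ev_mul_cons, ih, ev_one_cons, mul_zero, zero_add, ev_cons]
    mul_assoc := fun α β γ => by
      -- The head of `α β` is a left multiple of `head β x` plus `head α x * β`, so associativity by
      -- induction needs left homogeneity (`hl`) and additivity (`ha`) in the first factor.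
      have hl : ∀ (r : R) (α β : MSeries E R) (l : List E),
          ev (map (LinearMap.mulLeft ℂ r) α * β) l = r * ev (α * β) l := fun r α β l => by
        induction l generalizing α with
        | nil => simp [ev_mul_nil, mul_assoc]
        | cons x l ih =>
          rw [ev_mul_cons, ev_mul_cons, head_map, ih, mul_add, ev_map]
          simp [mul_assoc]
      have ha : ∀ (α β γ : MSeries E R) (l : List E),
          ev ((α + β) * γ) l = ev (α * γ) l + ev (β * γ) l := fun α β γ l => by
        induction l generalizing α β with
        | nil => simp [ev_mul_nil, add_mul]
        | cons x l ih =>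
          have h : ev (head (α + β) x * γ) l = _ := ih (head α x) (head β x)
          simp only [ev_add, ev_mul_cons, h, add_mul]
          abel
      refine ext_ev fun l => ?_
      induction l generalizing α β with
      | nil => simp [ev_mul_nil, mul_assoc]
      | cons x l ih =>
        have hh : head (α * β) x = map (LinearMap.mulLeft ℂ (ev α [])) (head β x) + head α x * β :=
          ext_ev fun l => by
            rw [← ev_cons, ev_mul_cons, ev_add, ev_map, LinearMap.mulLeft_apply, ev_cons β]
        rw [ev_mul_cons, hh, ha, hl, ih, ev_mul_nil, ev_mul_cons α, ev_mul_cons β]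
        simp only [mul_add, mul_assoc, add_assoc] }

theorem head_mul (α β : MSeries E R) (x : E) :
    head (α * β) x = map (LinearMap.mulLeft ℂ (ev α [])) (head β x) + head α x * β :=
  ext_ev fun l => by
    rw [← ev_cons, ev_mul_cons, ev_add, ev_map, LinearMap.mulLeft_apply, ev_cons β]

theorem const_one : const E (1 : R) = 1 :=
  ext_ev fun l => by cases l <;> rfl

theorem ev_const_mul (r : R) (α : MSeries E R) (l : List E) :
    ev (const E r * α) l = r * ev α l := by
  cases l with
  | nil => rw [ev_mul_nil, ev_const_nil]
  | cons x l => rw [ev_mul_cons, ev_const_nil, head_const, zero_mul, ev_zero, add_zero]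

end Ring

/-! ### Sums over compositions, and substitution with a distinguished last block. -/

section Compositions

variable {E F G : Type*} [AddCommGroup E] [Module ℂ E] [AddCommGroup F] [Module ℂ F]
  [AddCommGroup G] [Module ℂ G]

theorem comp_map {H : Type*} [AddCommGroup H] [Module ℂ H]
    (f : G →ₗ[ℂ] H) (α : MSeries F G) (γ : MSeries E F) :
    comp (map f α) γ = map f (comp α γ) := by
  funext n
  ext v
  change (∑ c : Composition n, plugBlocks c (map f α c.length) fun _ => γ) v =
    f ((∑ c : Composition n, plugBlocks c (α c.length) fun _ => γ) v)
  rw [sum_apply, sum_apply, map_sum]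
  rfl

theorem sum_composition_zero {M : Type*} [AddCommMonoid M] {n : ℕ} (hn : n = 0) (f : List ℕ → M) :
    ∑ c : Composition n, f c.blocks = f [] := by
  subst hn
  have h : ∀ c : Composition 0, c.blocks = [] := fun c => by simp
  simp [h, composition_card]

/-- Splitting off the first block, of size `k + 1`, leaves an arbitrary composition of `n - k`. -/
theorem sum_composition_succ {M : Type*} [AddCommMonoid M] (n : ℕ) (f : List ℕ → M) :
    ∑ c : Composition (n + 1), f c.blocks =
      ∑ k : Fin (n + 1), ∑ c : Composition (n - k), f ((k + 1 : ℕ) :: c.blocks) := by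
  rw [Finset.sum_sigma']
  symm
  refine Finset.sum_bij (fun s _ => ⟨(s.1 + 1 : ℕ) :: s.2.blocks, ?_, ?_⟩) (fun _ _ => by simp) ?_ ?_
    (fun _ _ => rfl)
  · intro i hi
    rcases List.mem_cons.1 hi with rfl | hi
    · omega
    · exact s.2.blocks_pos hi
  · rw [List.sum_cons, s.2.blocks_sum]
    omega
  · rintro ⟨⟨k, hk⟩, c⟩ - ⟨⟨k', hk'⟩, c'⟩ - h
    simp only [Composition.mk.injEq, List.cons.injEq, add_left_inj] at h
    obtain ⟨rfl, h⟩ := h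
    congr
    exact Composition.ext h
  · rintro ⟨bl, hpos, hsum⟩ -
    cases bl with
    | nil => simp at hsum
    | cons q bl =>
      have hq : 0 < q := hpos (by simp)
      rw [List.sum_cons] at hsum
      refine ⟨⟨⟨q - 1, by omega⟩, ⟨bl, fun hi => hpos (by simp [hi]), ?_⟩⟩, Finset.mem_univ _, ?_⟩
      · simp only
        omega
      · ext1
        simp only [List.cons.injEq, and_true]
        omega

/-- The substitution product in which the last block is filled with the series `β'` and all the
other blocks with the series `β`. -/
def compLast (α : MSeries F G) (β β' : MSeries E F) : MSeries E G :=
  fun n => ∑ c : Composition n, plugBlocks c (α c.length)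
    (fun j => if (j : ℕ) + 1 = c.length then β' else β)

theorem compLast_self (α : MSeries F G) (β : MSeries E F) : compLast α β β = comp α β := by
  funext n
  simp only [compLast, comp, ite_self]

/-- The values of `β` (for the last block, of `β'`) on the successive blocks, of the prescribed
sizes, of a word. -/
def blockValues (β β' : MSeries E F) : List ℕ → List E → List F
  | [], _ => []
  | q :: bl, l => ev (if bl = [] then β' else β) (l.take q) :: blockValues β β' bl (l.drop q)

theorem length_blockValues (β β' : MSeries E F) (bl : List ℕ) (l : List E) :
    (blockValues β β' bl l).length = bl.length := by
  induction bl generalizing l with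
  | nil => rfl
  | cons q bl ih => simp [blockValues, ih]

theorem getElem_blockValues (β β' : MSeries E F) (bl : List ℕ) (l : List E) (i : ℕ)
    (hi : i < (blockValues β β' bl l).length) (hi' : i < bl.length) :
    (blockValues β β' bl l)[i] =
      ev (if i + 1 = bl.length then β' else β) ((l.drop (bl.take i).sum).take bl[i]) := by
  induction bl generalizing l i with
  | nil => simp at hi'
  | cons q bl ih =>
    cases i with
    | zero =>
      simp only [blockValues, List.getElem_cons_zero, List.take_zero, List.sum_nil, List.drop_zero]
      cases bl <;> simp
    | succ i =>
      simp only [blockValues, List.getElem_cons_succ]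
      rw [ih _ i (by simpa [blockValues] using hi) (by simpa using hi')]
      simp [List.drop_drop]

theorem plugBlocks_eq_ev (α : MSeries F G) (β β' : MSeries E F) {n : ℕ} (c : Composition n)
    (v : Fin n → E) :
    plugBlocks c (α c.length) (fun j => if (j : ℕ) + 1 = c.length then β' else β) v =
      ev α (blockValues β β' c.blocks (List.ofFn v)) := by
  rw [plugBlocks_apply]
  refine coeff_congr α (length_blockValues ..).symm fun i hm hn => ?_
  rw [List.get_eq_getElem, getElem_blockValues _ _ _ _ _ _ hm]
  rw [coeff_eq_ev]
  congr 1
  refine List.ext_getElem ?_ ?_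
  · have h1 := c.sizeUpTo_succ hm
    have h2 := c.sizeUpTo_le (i + 1)
    simp only [Composition.sizeUpTo] at h1 h2
    simp only [List.length_ofFn, List.length_take, List.length_drop, Composition.blocksFun,
      List.get_eq_getElem]
    omega
  · intro j h1 h2
    simp only [List.getElem_ofFn, Function.comp_apply, List.getElem_take, List.getElem_drop]
    rfl

theorem ev_compLast (α : MSeries F G) (β β' : MSeries E F) (l : List E) :
    ev (compLast α β β') l =
      ∑ c : Composition l.length, ev α (blockValues β β' c.blocks l) := by
  change (∑ c : Composition l.length, plugBlocks c (α c.length)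
    (fun j => if (j : ℕ) + 1 = c.length then β' else β)) l.get = _
  rw [sum_apply]
  refine Finset.sum_congr rfl fun c _ => ?_
  rw [plugBlocks_eq_ev, List.ofFn_get]

theorem ev_compLast_nil (α : MSeries F G) (β β' : MSeries E F) :
    ev (compLast α β β') [] = ev α [] := by
  rw [ev_compLast]
  exact sum_composition_zero rfl fun bl => ev α (blockValues β β' bl [])

/-- The sum runs over the first block `y :: l.take k`. The case where it is the whole word stands
apart, since the block is then also the last one and is filled with `β'`. -/
theorem ev_compLast_cons (α : MSeries F G) (β β' : MSeries E F) (y : E) (l : List E) :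
    ev (compLast α β β') (y :: l) =
      ∑ k ∈ Finset.range l.length,
        ev (compLast (head α (ev β (y :: l.take k))) β β') (l.drop k) + ev α [ev β' (y :: l)] := by
  rw [ev_compLast, ← Fin.sum_univ_eq_sum_range
    (fun k => ev (compLast (head α (ev β (y :: l.take k))) β β') (l.drop k))]
  change ∑ c : Composition (l.length + 1), _ = _
  rw [sum_composition_succ l.length fun bl => ev α (blockValues β β' bl (y :: l)),
    Fin.sum_univ_castSucc]
  refine congr_arg₂ _ (Finset.sum_congr rfl fun k _ => ?_) ?_
  · rw [ev_compLast]
    have h : (l.drop k).length = l.length - k := List.length_drop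
    have gen : ∀ (m : ℕ) (_ : 0 < m) (f g : List ℕ → G) (_ : ∀ bl ≠ [], f bl = g bl) (m' : ℕ)
        (_ : m' = m), ∑ c : Composition m, f c.blocks = ∑ c : Composition m', g c.blocks := by
      rintro m hm f g hfg _ rfl
      exact Finset.sum_congr rfl fun c _ => hfg _ fun hc => by
        rw [Composition.blocks_eq_nil] at hc; omega
    refine gen _ (by simp) (fun bl => ev α (blockValues β β' ((k + 1 : ℕ) :: bl) (y :: l)))
      (fun bl => ev (head α (ev β (y :: l.take k))) (blockValues β β' bl (l.drop k)))
      (fun bl hbl => ?_) _ h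
    simp [blockValues, hbl, ev_cons]
  · rw [sum_composition_zero (by simp) fun bl => ev α (blockValues β β' (_ :: bl) _)]
    simp [blockValues]

end Compositions

/-! ### Linearity, units and associativity of composition. -/

section Comp

variable {E F G H : Type*} [AddCommGroup E] [Module ℂ E] [AddCommGroup F] [Module ℂ F]
  [AddCommGroup G] [Module ℂ G] [AddCommGroup H] [Module ℂ H]

theorem ev_comp (α : MSeries F G) (β : MSeries E F) (l : List E) :
    ev (comp α β) l = ∑ c : Composition l.length, ev α (blockValues β β c.blocks l) := by
  rw [← compLast_self, ev_compLast]

theorem ev_comp_nil (α : MSeries F G) (β : MSeries E F) : ev (comp α β) [] = ev α [] := by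
  rw [← compLast_self, ev_compLast_nil]

theorem ev_comp_cons (α : MSeries F G) (β : MSeries E F) (y : E) (l : List E) :
    ev (comp α β) (y :: l) =
      ∑ k ∈ Finset.range (l.length + 1),
        ev (comp (head α (ev β (y :: l.take k))) β) (l.drop k) := by
  simp only [← compLast_self]
  rw [ev_compLast_cons, Finset.sum_range_succ, List.drop_length, List.take_length,
    ev_compLast_nil, ev_cons α]

theorem add_comp (α β : MSeries F G) (γ : MSeries E F) :
    comp (α + β) γ = comp α γ + comp β γ :=
  ext_ev fun l => by simp only [ev_comp, ev_add, Finset.sum_add_distrib]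

theorem sub_comp (α β : MSeries F G) (γ : MSeries E F) :
    comp (α - β) γ = comp α γ - comp β γ :=
  ext_ev fun l => by simp only [ev_comp, ev_sub, Finset.sum_sub_distrib]

theorem zero_comp (γ : MSeries E F) : comp (0 : MSeries F G) γ = 0 :=
  ext_ev fun l => by simp only [ev_comp, ev_zero, Finset.sum_const_zero]

theorem const_comp (r : G) (γ : MSeries E F) : comp (const F r) γ = const E r := by
  refine ext_ev fun l => ?_
  cases l with
  | nil => rw [ev_comp_nil, ev_const_nil, ev_const_nil]
  | cons x l => simp [ev_comp_cons, head_const, zero_comp, ev_const_cons]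

theorem ev_head_ident (x : E) (l : List E) : ev (head (ident E) x) l = ev (const E x) l := by
  rw [← ev_cons]
  cases l <;> rfl

theorem head_ident (x : E) : head (ident E) x = const E x := ext_ev (ev_head_ident x)

theorem ident_comp (γ : MSeries E F) (hγ : ev γ [] = 0) : comp (ident F) γ = γ := by
  refine ext_ev fun l => ?_
  cases l with
  | nil => rw [ev_comp_nil, hγ, ev_ident_nil]
  | cons x l =>
    rw [ev_comp_cons, Finset.sum_range_succ, Finset.sum_eq_zero, zero_add]
    · simp [head_ident, const_comp, ev_const_nil]
    · intro k hk
      have h : l.drop k ≠ [] := by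
        have := Finset.mem_range.1 hk
        simpa using this
      obtain ⟨y, l', h'⟩ := List.exists_cons_of_ne_nil h
      rw [h', head_ident, const_comp, ev_const_cons]

theorem comp_ident (γ : MSeries E F) : comp γ (ident E) = γ := by
  refine ext_ev fun l => ?_
  induction l generalizing γ with
  | nil => rw [ev_comp_nil]
  | cons x l ih =>
    rw [ev_comp_cons, Finset.sum_range_succ', Finset.sum_eq_zero, zero_add]
    · simp [ev_ident_singleton, ih, ev_cons γ]
    · intro k hk
      have hk := Finset.mem_range.1 hk
      cases l with
      | nil => simp at hk
      | cons y l =>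
        rw [List.take_succ_cons, ev_ident_cons_cons]
        -- A first block of at least two letters is sent to `0` by the identity series, and
        -- multilinearity kills the term.
        have : head γ 0 = 0 := by
          funext n
          exact map_zero _
        rw [this, zero_comp, ev_zero]

theorem comp_apply (α : MSeries F G) (β : MSeries E F) {n : ℕ} (v : Fin n → E) :
    comp α β n v = ∑ c : Composition n,
      α c.length fun i => β (c.blocksFun i) (v ∘ c.embedding i) := by
  rw [comp, sum_apply]
  rfl

open Composition in
/-- The composition product is associative. -/
theorem comp_assoc (α : MSeries G H) (β : MSeries F G) (γ : MSeries E F) :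
    comp (comp α β) γ = comp α (comp β γ) := by
  funext n
  ext v
  let f : (Σ a : Composition n, Composition a.length) → H := fun c =>
    α c.2.length fun i => β (c.2.blocksFun i)
      ((fun i => γ (c.1.blocksFun i) (v ∘ c.1.embedding i)) ∘ c.2.embedding i)
  let g : (Σ c : Composition n, ∀ i : Fin c.length, Composition (c.blocksFun i)) → H := fun c =>
    α c.1.length fun i : Fin c.1.length =>
      β (c.2 i).length fun j => γ ((c.2 i).blocksFun j) ((v ∘ c.1.embedding i) ∘ (c.2 i).embedding j)
  suffices h : ∑ c, f c = ∑ c, g c by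
    rw [← Finset.univ_sigma_univ, Finset.sum_sigma, ← Finset.univ_sigma_univ,
      Finset.sum_sigma] at h
    simp only [comp_apply, MultilinearMap.map_sum]
    exact h
  rw [← (sigmaEquivSigmaPi n).sum_comp]
  apply Finset.sum_congr rfl
  rintro ⟨a, b⟩ _
  refine coeff_congr α (Composition.length_gather a b).symm fun i hi1 hi2 => ?_
  refine coeff_congr β (length_sigmaCompositionAux a b _).symm fun j hj1 hj2 => ?_
  refine coeff_congr γ (blocksFun_sigmaCompositionAux a b _ _).symm fun k hk1 hk2 => ?_
  refine congr_arg v (Fin.ext ?_)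
  change a.sizeUpTo (b.sizeUpTo i + j) + k =
    (a.gather b).sizeUpTo i + ((a.sigmaCompositionAux b ⟨i, hi2⟩).sizeUpTo j + k)
  rw [← add_assoc, ← sizeUpTo_sizeUpTo_add _ _ hi1 hj1]

end Comp

/-! ### Compatibility of composition with the Cauchy product. -/

section CompRing

variable {E F R : Type*} [AddCommGroup E] [Module ℂ E] [AddCommGroup F] [Module ℂ F]
  [Ring R] [Algebra ℂ R]

theorem one_comp (γ : MSeries E F) : comp (1 : MSeries F R) γ = 1 := by
  rw [← const_one, const_comp, const_one]

/-- The head of a substitution is not itself a substitution, but a sum over the prefix absorbed by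
the first block. Right multiplication by `β` passes through such a sum because it affects only what
follows the prefix. -/
theorem ev_mul_of_sum_prefix (w : List E → MSeries E R) (δ β : MSeries E R)
    (h : ∀ l, ev δ l = ∑ k ∈ Finset.range (l.length + 1), ev (w (l.take k)) (l.drop k))
    (l : List E) :
    ev (δ * β) l = ∑ k ∈ Finset.range (l.length + 1), ev (w (l.take k) * β) (l.drop k) := by
  induction l generalizing w δ with
  | nil =>
    have := h []
    simp only [List.length_nil, zero_add, Finset.sum_range_one, List.take_nil, List.drop_nil]
      at this ⊢
    rw [ev_mul_nil, ev_mul_nil, this]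
  | cons y l ih =>
    have h0 := h []
    simp only [List.length_nil, zero_add, Finset.sum_range_one, List.take_nil, List.drop_nil] at h0
    have h1 := ih (fun u => w (y :: u)) (head δ y - head (w []) y) fun l' => by
      rw [ev_sub, ← ev_cons, ← ev_cons, h, Finset.sum_range_succ']
      simp
    rw [sub_mul, ev_sub, sub_eq_iff_eq_add] at h1
    rw [ev_mul_cons, h1, List.length_cons, Finset.sum_range_succ' _ (l.length + 1)]
    simp only [List.take_zero, List.drop_zero, List.take_succ_cons, List.drop_succ_cons]
    rw [ev_mul_cons (w []), h0]
    abel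

/-- Substitution is multiplicative for the Cauchy product. -/
theorem mul_comp (α β : MSeries F R) (γ : MSeries E F) :
    comp (α * β) γ = comp α γ * comp β γ := by
  refine ext_ev fun l => ?_
  induction hn : l.length using Nat.strong_induction_on generalizing α l with
  | _ n ih =>
    cases l with
    | nil => rw [ev_comp_nil, ev_mul_nil, ev_mul_nil, ev_comp_nil, ev_comp_nil]
    | cons x l =>
      subst hn
      rw [ev_comp_cons, ev_mul_cons, ev_comp_nil, ev_comp_cons β,
        ev_mul_of_sum_prefix (fun u => comp (head α (ev γ (x :: u))) γ) (head (comp α γ) x)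
          (comp β γ) (fun l' => by rw [← ev_cons, ev_comp_cons]), Finset.mul_sum,
        ← Finset.sum_add_distrib]
      refine Finset.sum_congr rfl fun k _ => ?_
      rw [head_mul, add_comp, ev_add, comp_map, ev_map, LinearMap.mulLeft_apply,
        ih _ _ _ _ rfl]
      simp only [List.length_drop, List.length_cons]
      omega

end CompRing

/-! ### Cauchy inverses and coefficients in a subalgebra. -/

section Inverse

variable {E R : Type*} [AddCommGroup E] [Module ℂ E] [Ring R] [Algebra ℂ R]

theorem mul_cinv' {α : MSeries E R} (hα : ev α [] = 1) : α * cinv α = 1 :=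
  mul_cinv α fun v => by rw [← hα, ev_nil α v]

theorem ev_cinv_nil {α : MSeries E R} (hα : ev α [] = 1) : ev (cinv α) [] = 1 := by
  have := congr_arg (fun β => ev β []) (mul_cinv' hα)
  simpa [ev_mul_nil, hα, ev_one_nil] using this

theorem cinv_mul {α : MSeries E R} (hα : ev α [] = 1) : cinv α * α = 1 := by
  have h1 := mul_cinv' hα
  have h2 := mul_cinv' (ev_cinv_nil hα)
  rwa [← left_inv_eq_right_inv h1 h2] at h2

theorem eq_cinv_of_mul_eq_one {α β : MSeries E R} (hα : ev α [] = 1) (h : α * β = 1) :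
    β = cinv α :=
  (left_inv_eq_right_inv (cinv_mul hα) h).symm

theorem comp_cinv {F : Type*} [AddCommGroup F] [Module ℂ F] {α : MSeries F R} (hα : ev α [] = 1)
    (γ : MSeries E F) : comp (cinv α) γ = cinv (comp α γ) :=
  eq_cinv_of_mul_eq_one (by rw [ev_comp_nil, hα])
    (by rw [← mul_comp, mul_cinv' hα, one_comp])

theorem ev_cinv_mem (S : Subalgebra ℂ R) {α : MSeries E R} (hα : ∀ l, ev α l ∈ S) (l : List E) :
    ev (cinv α) l ∈ S := by
  have key : ∀ n (v : Fin n → E), cinv α n v ∈ S := by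
    intro n
    induction n using Nat.strong_induction_on with
    | _ n ih =>
      intro v
      rw [cinv, sub_apply, sum_apply]
      refine S.sub_mem ?_ (S.sum_mem fun k _ => ?_)
      · rw [coeff_eq_ev]
        cases List.ofFn v with
        | nil => exact S.one_mem
        | cons x l => exact S.zero_mem
      · rw [mulAt_apply, coeff_eq_ev]
        exact S.mul_mem (hα _) (ih _ (by omega) _)
  exact key _ _

theorem ev_mul_mem (S : Subalgebra ℂ R) {α β : MSeries E R} (hα : ∀ l, ev α l ∈ S)
    (hβ : ∀ l, ev β l ∈ S) (l : List E) : ev (α * β) l ∈ S := by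
  induction l generalizing α with
  | nil => rw [ev_mul_nil]; exact S.mul_mem (hα _) (hβ _)
  | cons x l ih =>
    rw [ev_mul_cons]
    exact S.add_mem (S.mul_mem (hα _) (hβ _)) (ih fun l' => by rw [← ev_cons]; exact hα _)

end Inverse

/-! ### Translations by the identity series. -/

section Ident

variable {B : Type*} [Ring B] [Algebra ℂ B]

theorem ev_ident_mul_nil (α : MSeries B B) : ev (ident B * α) [] = 0 := by
  rw [ev_mul_nil, ev_ident_nil, zero_mul]

theorem ev_mul_ident_nil (α : MSeries B B) : ev (α * ident B) [] = 0 := by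
  rw [ev_mul_nil, ev_ident_nil, mul_zero]

theorem ev_ident_mul_cons (α : MSeries B B) (b : B) (l : List B) :
    ev (ident B * α) (b :: l) = b * ev α l := by
  rw [ev_mul_cons, ev_ident_nil, zero_mul, zero_add, head_ident, ev_const_mul]

/-- Evaluating on words whose first letter is `1` recovers the second factor. -/
theorem ident_mul_cancel {α β : MSeries B B} (h : ident B * α = ident B * β) : α = β := by
  refine ext_ev fun l => ?_
  have := congr_arg (fun γ => ev γ (1 :: l)) h
  simpa [ev_ident_mul_cons] using this

theorem ident_comp_mul (α γ : MSeries B B) (hγ : ev γ [] = 0) :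
    comp (ident B * α) γ = γ * comp α γ := by
  rw [mul_comp, ident_comp γ hγ]

theorem comp_mul_ident (α γ : MSeries B B) (hγ : ev γ [] = 0) :
    comp (α * ident B) γ = comp α γ * γ := by
  rw [mul_comp, ident_comp γ hγ]

end Ident

end MSeries

open MSeries

/-! ### Inverses for `⋆_λ` and the subordination equation. -/

section Subordination

variable {B : Type*} [Ring B] [Algebra ℂ B]

theorem ident_mul_coeff_one {g : MSeries B B} (hg : ev g [] = 1) (v : Fin 1 → B) :
    (ident B * g) 1 v = v 0 := by
  rw [coeff_eq_ev, List.ofFn_succ, List.ofFn_zero, ev_ident_mul_cons, hg, mul_one]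

theorem starLambdaInv_comp {g : MSeries B B} (hg : ev g [] = 1) :
    comp (starLambdaInv g) (ident B * g) = cinv g :=
  compDiv_comp _ _ (ident_mul_coeff_one hg)

theorem ev_starLambdaInv_nil {g : MSeries B B} (hg : ev g [] = 1) :
    ev (starLambdaInv g) [] = 1 := by
  rw [← ev_comp_nil _ (ident B * g), starLambdaInv_comp hg, ev_cinv_nil hg]

theorem ident_mul_starLambdaInv_comp {g : MSeries B B} (hg : ev g [] = 1) :
    comp (ident B * starLambdaInv g) (ident B * g) = ident B := by
  rw [ident_comp_mul _ _ (ev_ident_mul_nil _), starLambdaInv_comp hg, mul_assoc, mul_cinv' hg,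
    mul_one]

/-- A left inverse for the composition product, starting with `I`, is a right inverse. -/
theorem comp_eq_ident_comm {α β : MSeries B B} (h : comp α β = ident B)
    (hα : ∀ v, α 1 v = v 0) (hβ : ev β [] = 0) : comp β α = ident B := by
  have h1 := compDiv_comp (ident B) α hα
  have h2 : compDiv (ident B) α = β := by
    calc compDiv (ident B) α = comp (compDiv (ident B) α) (comp α β) := by rw [h, comp_ident]
      _ = β := by rw [← comp_assoc, h1, ident_comp β hβ]
  rwa [h2] at h1

theorem ident_mul_comp_starLambdaInv {g : MSeries B B} (hg : ev g [] = 1) :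
    comp (ident B * g) (ident B * starLambdaInv g) = ident B :=
  comp_eq_ident_comm (ident_mul_starLambdaInv_comp hg)
    (ident_mul_coeff_one (ev_starLambdaInv_nil hg)) (ev_ident_mul_nil _)

/-- With `X = starLambdaInv (f ·_ρ h)`, the inverse `f'` of `f` satisfies `f' ·_ρ (h ·_λ X) = X`. -/
theorem actRho_starLambdaInv {f h : MSeries B B} (hf : ev f [] = 1) (hh : ev h [] = 1) :
    actRho (starLambdaInv f) (actLambda h (starLambdaInv (actRho f h))) =
      starLambdaInv (actRho f h) := by
  set g := actRho f h with hg_def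
  have hg : ev g [] = 1 := by rw [hg_def, actRho, ev_comp_nil, hf]
  set X := starLambdaInv g with hX
  set Y := actLambda h X with hY
  have hY0 : ev Y [] = 1 := by rw [hY, actLambda, ev_comp_nil, hh]
  -- This is `λ(g) ∘ λ(X) = I` with the leading `I` cancelled.
  have h1 : X * comp g (ident B * X) = 1 := by
    apply ident_mul_cancel
    rw [← mul_assoc, ← ident_comp_mul _ _ (ev_ident_mul_nil _),
      ident_mul_comp_starLambdaInv hg, mul_one]
  have h2 : comp g (ident B * X) = comp f (Y * ident B * X) := by
    rw [hg_def, actRho, comp_assoc, comp_mul_ident _ _ (ev_ident_mul_nil _), ← mul_assoc]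
    rfl
  have hZ : ev (Y * ident B * X) [] = 0 := by
    rw [ev_mul_nil, ev_mul_ident_nil, zero_mul]
  -- Since `g ∘ (I X) = f ∘ (Y I X)`, the relation `h1` says that `λ(f)` sends `Y I X` to `Y I`.
  -- Applying `λ(f)⁻¹` and cancelling `Y` and `I` on the left gives the claim.
  have h3 : comp (ident B * f) (Y * ident B * X) = Y * ident B := by
    rw [ident_comp_mul _ _ hZ, ← h2, mul_assoc, h1, mul_one]
  have h4 : comp (ident B * starLambdaInv f) (Y * ident B) = Y * ident B * X := by
    conv_lhs => rw [← h3]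
    rw [← comp_assoc, ident_mul_starLambdaInv_comp hf, ident_comp _ hZ]
  rw [ident_comp_mul _ _ (ev_mul_ident_nil _)] at h4
  have h5 := congr_arg (fun Z => cinv Y * Z) h4
  simp only [← mul_assoc, cinv_mul hY0, one_mul] at h5
  exact ident_mul_cancel h5

end Subordination

/-! ### Isolating the composition into singletons. -/

section LastBlock

variable {E G : Type*} [AddCommGroup E] [Module ℂ E] [AddCommGroup G] [Module ℂ G]

theorem MSeries.blockValues_replicate_one {β β' : MSeries E E} (hβ : ∀ x, ev β [x] = x)
    (hβ' : ∀ x, ev β' [x] = x) (l : List E) :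
    blockValues β β' (List.replicate l.length 1) l = l := by
  induction l with
  | nil => rfl
  | cons x l ih =>
    rw [List.length_cons, List.replicate_succ, blockValues]
    simp only [List.take_succ_cons, List.take_zero, List.drop_succ_cons, List.drop_zero, ih]
    split_ifs <;> simp [hβ, hβ']

/-- On blocks of size one both fillings are the identity, so the composition with all blocks equal
to `1` contributes `α n`. The rest is the lower-order part of the cumulant recursion. -/
theorem MSeries.compLast_eq_add {β β' : MSeries E E} (hβ : ∀ x, ev β [x] = x)
    (hβ' : ∀ x, ev β' [x] = x) (α : MSeries E G) (n : ℕ) :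
    compLast α β β' n = α n + ∑ c : {c : Composition n // c.length < n},
      plugBlocks c.1 (α c.1.length) (fun j => if (j : ℕ) + 1 = c.1.length then β' else β) := by
  classical
  rw [compLast, ← Finset.add_sum_erase _ _ (Finset.mem_univ (Composition.ones n))]
  congr 1
  · ext v
    rw [plugBlocks_eq_ev, coeff_eq_ev]
    congr 1
    have := blockValues_replicate_one hβ hβ' (List.ofFn v)
    rwa [List.length_ofFn] at this
  · refine Finset.sum_subtype _ (fun c => ?_) fun c : Composition n =>
      plugBlocks c (α c.length) (fun j => if (j : ℕ) + 1 = c.length then β' else β)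
    rw [Finset.mem_erase, Ne, Composition.eq_ones_iff_le_length]
    simp

theorem MSeries.ev_compLast_eq_add {β β' : MSeries E E} (hβ : ∀ x, ev β [x] = x)
    (hβ' : ∀ x, ev β' [x] = x) (α : MSeries E G) {n : ℕ} (l : List E) (hl : l.length = n) :
    ev (compLast α β β') l = ev α l + ∑ c : {c : Composition n // c.length < n},
      ev α (blockValues β β' c.1.blocks l) := by
  subst hl
  have := congr_arg (fun f => f l.get) (compLast_eq_add hβ hβ' α l.length)
  simp only [add_apply, sum_apply, plugBlocks_eq_ev, List.ofFn_get] at this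
  exact this

end LastBlock

/-! ### Moment-cumulant formulas. -/

section Cumulants

variable {A B : Type*} [Ring A] [Algebra ℂ A] [Ring B] [Algebra ℂ B]
  {ι : B →ₐ[ℂ] A} {φ ψ : A →ₗ[ℂ] B}

theorem IsCondExp.map_mul_left (hφ : IsCondExp ι φ) (b : B) (x : A) : φ (ι b * x) = b * φ x := by
  simpa using hφ.map_bimod b 1 x

theorem IsCondExp.map_mul_right (hφ : IsCondExp ι φ) (x : A) (b : B) : φ (x * ι b) = φ x * b := by
  simpa using hφ.map_bimod 1 b x

theorem ev_moments {F : Type*} [AddCommGroup F] [Module ℂ F] (φ : A →ₗ[ℂ] F) (l : List A) :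
    ev (moments φ) l = φ l.prod := by
  change φ (MultilinearMap.mkPiAlgebraFin ℂ l.length A l.get) = _
  rw [MultilinearMap.mkPiAlgebraFin_apply, List.ofFn_get]

theorem ev_headMoments_cons (ι : B →ₐ[ℂ] A) (ψ : A →ₗ[ℂ] B) (y : A) (l : List A) :
    ev (headMoments ι ψ) (y :: l) = y * ι (ψ l.prod) := by
  rw [headMoments, ev_ident_mul_cons, ev_moments]
  rfl

theorem ev_headMoments_singleton (hψ : IsCondExp ι ψ) (y : A) :
    ev (headMoments ι ψ) [y] = y := by
  rw [ev_headMoments_cons, List.prod_nil, hψ.map_one, map_one, mul_one]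

theorem ev_headMoments_concat (hψ : IsCondExp ι ψ) (l : List A) (a : A) (b : B) :
    ev (headMoments ι ψ) (l ++ [a * ι b]) = ev (headMoments ι ψ) (l ++ [a]) * ι b := by
  cases l with
  | nil => simp [ev_headMoments_singleton hψ]
  | cons y l =>
    rw [List.cons_append, List.cons_append, ev_headMoments_cons, ev_headMoments_cons,
      List.prod_append, List.prod_append, List.prod_singleton, List.prod_singleton, ← mul_assoc,
      hψ.map_mul_right, map_mul, mul_assoc]

theorem compLast_freeCumulants (hψ : IsCondExp ι ψ) :
    compLast (freeCumulants ι ψ) (headMoments ι ψ) (headMoments ι ψ) = moments ψ := by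
  rw [compLast_self, freeCumulants, compDiv_comp]
  intro v
  rw [coeff_eq_ev, List.ofFn_succ, List.ofFn_zero, ev_headMoments_singleton hψ]

theorem compLast_condCumulants (hφ : IsCondExp ι φ) (hψ : IsCondExp ι ψ) :
    compLast (condCumulants ι φ ψ) (headMoments ι ψ) (headMoments ι φ) = moments φ := by
  funext n
  rw [compLast_eq_add (ev_headMoments_singleton hψ) (ev_headMoments_singleton hφ), condCumulants]
  exact sub_add_cancel _ _

/-- A right factor from `B` on the last letter reaches only the last block, where right
`B`-linearity of `φ` pulls it out. Positivity of the block sizes keeps that letter out of the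
earlier blocks. -/
theorem exists_blockValues_concat (hφ : IsCondExp ι φ) (b : B) (a : A) (bl : List ℕ)
    (hbl : ∀ q ∈ bl, 0 < q) (l : List A) (hl : bl.sum = l.length + 1) :
    ∃ (u : List A) (z : A), u.length + 1 = bl.length ∧
      blockValues (headMoments ι ψ) (headMoments ι φ) bl (l ++ [a]) = u ++ [z] ∧
      blockValues (headMoments ι ψ) (headMoments ι φ) bl (l ++ [a * ι b]) = u ++ [z * ι b] := by
  induction bl generalizing l with
  | nil => simp at hl
  | cons q bl ih =>
    by_cases h : bl = []
    · subst h
      refine ⟨[], ev (headMoments ι φ) (l ++ [a]), rfl, ?_, ?_⟩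
      all_goals
        simp only [List.sum_cons, List.sum_nil, add_zero] at hl
        simp [blockValues, hl, ev_headMoments_concat hφ, List.take_of_length_le]
    · obtain ⟨r, bl', rfl⟩ := List.exists_cons_of_ne_nil h
      have hr : 0 < r := hbl r (by simp)
      simp only [List.sum_cons] at hl
      obtain ⟨u, z, h1, h2, h3⟩ := ih (fun q hq => hbl q (List.mem_cons_of_mem _ hq)) (l.drop q)
        (by rw [List.length_drop, List.sum_cons]; omega)
      have hq : q ≤ l.length := by omega
      refine ⟨ev (headMoments ι ψ) (l.take q) :: u, z, by simp [← h1], ?_, ?_⟩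
      · rw [blockValues, List.drop_append_of_le_length hq, h2, if_neg h,
          List.take_append_of_le_length hq, List.cons_append]
      · rw [blockValues, List.drop_append_of_le_length hq, h3, if_neg h,
          List.take_append_of_le_length hq, List.cons_append]

/-- Compatibility of a series with the right action of `B` on its last argument. -/
def IsRightModular (ι : B →ₐ[ℂ] A) (κ : MSeries A B) : Prop :=
  ∀ (l : List A) (a : A) (b : B), ev κ (l ++ [a * ι b]) = ev κ (l ++ [a]) * b

theorem IsRightModular.head {κ : MSeries A B} (h : IsRightModular ι κ) (a : A) :
    IsRightModular ι (head κ a) := fun l a' b => by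
  rw [← ev_cons, ← ev_cons]
  exact h (a :: l) a' b

/-- The moments of `φ` are right modular, and the formula expresses `κ` as a moment minus terms with
shorter arguments, so induction on length applies. -/
theorem isRightModular_of_compLast (hφ : IsCondExp ι φ) (hψ : IsCondExp ι ψ) {κ : MSeries A B}
    (h : compLast κ (headMoments ι ψ) (headMoments ι φ) = moments φ) : IsRightModular ι κ := by
  intro l
  induction hn : l.length using Nat.strong_induction_on generalizing l with
  | _ n ih =>
    intro a b
    have h1 := ev_compLast_eq_add (ev_headMoments_singleton hψ) (ev_headMoments_singleton hφ)
      κ (n := n + 1) (l ++ [a]) (by simp [hn])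
    have h2 := ev_compLast_eq_add (ev_headMoments_singleton hψ) (ev_headMoments_singleton hφ)
      κ (n := n + 1) (l ++ [a * ι b]) (by simp [hn])
    rw [h, ev_moments] at h1 h2
    rw [← sub_eq_iff_eq_add] at h1 h2
    rw [← h1, ← h2, sub_mul, Finset.sum_mul, List.prod_append, List.prod_append,
      List.prod_singleton, List.prod_singleton, ← mul_assoc, hφ.map_mul_right]
    congr 1
    refine Finset.sum_congr rfl fun c _ => ?_
    obtain ⟨u, z, hu, e1, e2⟩ := exists_blockValues_concat (ψ := ψ) hφ b a c.1.blocks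
      (fun q hq => c.1.blocks_pos hq) l (by rw [c.1.blocks_sum, hn])
    have hc : c.1.blocks.length < n + 1 := c.2
    rw [e1, e2, ih u.length (by omega) u rfl]

/-- The word `x b₁, …, x bₙ, x`. -/
def cumulantWord (ι : B →ₐ[ℂ] A) (x : A) (l : List B) : List A := l.map (fun b => x * ι b) ++ [x]

theorem cumulantWord_cons (x : A) (b : B) (l : List B) :
    cumulantWord ι x (b :: l) = (x * ι b) :: cumulantWord ι x l := rfl

theorem ev_cumulantSeries (κ : MSeries A B) (x : A) (l : List B) :
    ev (cumulantSeries ι κ x) l = ev κ (cumulantWord ι x l) := by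
  rw [ev, cumulantSeries_apply]
  refine coeff_congr κ (by simp [cumulantWord]) fun i hm hn => ?_
  rw [List.get_eq_getElem]
  simp only [cumulantWord, Fin.snoc]
  by_cases h : i < l.length
  · simp [h, List.getElem_append_left]
  · have : i = l.length := by omega
    subst this
    simp

theorem head_cumulantSeries (κ : MSeries A B) (x : A) (b : B) :
    head (cumulantSeries ι κ x) b = cumulantSeries ι (head κ (x * ι b)) x :=
  ext_ev fun l => by
    rw [← ev_cons, ev_cumulantSeries, ev_cumulantSeries, cumulantWord_cons, ev_cons]

/-- The moment-cumulant formula on words of the form `x b₁, …, x bₙ, x`. -/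
theorem ev_compLast_cumulantWord (hφ : IsCondExp ι φ) (x : A)
    {U V : MSeries B B}
    (hU : ∀ b l, ev U (b :: l) = b * ψ (l.map fun b => x * ι b).prod)
    (hV0 : ev V [] = 1) (hV : ∀ b l, ev V (b :: l) = b * φ (cumulantWord ι x l).prod)
    {κ : MSeries A B} (hκ : IsRightModular ι κ) (l : List B) :
    ev (compLast κ (headMoments ι ψ) (headMoments ι φ)) (cumulantWord ι x l) =
      ev (comp (cumulantSeries ι κ x) U * V) l := by
  induction hn : l.length using Nat.strong_induction_on generalizing κ l with
  | _ n ih =>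
    cases l with
    | nil =>
      rw [ev_mul_nil, ev_comp_nil, hV0, mul_one, ev_cumulantSeries]
      simp [cumulantWord, ev_compLast_cons, ev_headMoments_singleton hφ]
    | cons b l =>
      subst hn
      have hlen : (cumulantWord ι x l).length = l.length + 1 := by simp [cumulantWord]
      rw [ev_mul_cons, ev_comp_nil,
        ev_mul_of_sum_prefix (fun u => comp (head (cumulantSeries ι κ x) (ev U (b :: u))) U)
          (head (comp (cumulantSeries ι κ x) U) b) V
          (fun l' => by rw [← ev_cons, ev_comp_cons]),
        cumulantWord_cons, ev_compLast_cons, hlen, add_comm]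
      refine congr_arg₂ _ ?_ (Finset.sum_congr rfl fun k hk => ?_)
      -- The block is the first letter alone: everything to its right is evaluated by `φ`, and right
      -- modularity on a one-letter word moves this value out of `κ`.
      · rw [ev_headMoments_cons, ev_cumulantSeries, hV, mul_assoc, ← map_mul]
        exact hκ [] _ _
      · have hk : k ≤ l.length := by have := Finset.mem_range.1 hk; omega
        have e1 : (cumulantWord ι x l).take k = (l.take k).map fun b => x * ι b := by
          rw [cumulantWord, List.take_append_of_le_length (by simpa using hk), List.map_take]
        have e2 : (cumulantWord ι x l).drop k = cumulantWord ι x (l.drop k) := by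
          rw [cumulantWord, List.drop_append_of_le_length (by simpa using hk), cumulantWord,
            List.map_drop]
        -- The gap after the first point of the block is enclosed, so it is evaluated by `ψ` and
        -- becomes a coefficient of `U`.
        rw [e1, e2, ev_headMoments_cons, mul_assoc, ← map_mul, ← hU, head_cumulantSeries]
        exact ih _ (by simp) (hκ.head _) _ rfl

end Cumulants

/-! ### Series over `B` inside series over `A`, and coefficientwise conditional expectations. -/

section Extension

variable {E A B : Type*} [AddCommGroup E] [Module ℂ E] [Ring A] [Algebra ℂ A] [Ring B]
  [Algebra ℂ B] {ι : B →ₐ[ℂ] A} {φ ψ : A →ₗ[ℂ] B}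

/-- The coefficientwise extension of an algebra homomorphism to series. -/
def MSeries.incl (E : Type*) [AddCommGroup E] [Module ℂ E] (ι : B →ₐ[ℂ] A) :
    MSeries E B →+* MSeries E A :=
  { map ι.toLinearMap with
    map_one' := ext_ev fun l => by
      cases l with
      | nil => exact map_one ι
      | cons x l => exact map_zero ι
    map_mul' := fun α β => ext_ev fun l => by
      induction l generalizing α with
      | nil => exact (congr_arg ι (ev_mul_nil α β)).trans ((map_mul ι _ _).trans
          (ev_mul_nil (map ι.toLinearMap α) (map ι.toLinearMap β)).symm)
      | cons x l ih =>
        have h : ev (map ι.toLinearMap (head α x * β)) l =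
          ev (map ι.toLinearMap (head α x) * map ι.toLinearMap β) l := ih (head α x)
        change ι (ev (α * β) (x :: l)) = ev (map ι.toLinearMap α * map ι.toLinearMap β) (x :: l)
        rw [ev_mul_cons, ev_mul_cons, map_add, map_mul, head_map, ← h]
        rfl }

theorem MSeries.ev_incl (α : MSeries E B) (l : List E) : ev (incl E ι α) l = ι (ev α l) := rfl

theorem MSeries.comp_incl {F : Type*} [AddCommGroup F] [Module ℂ F] (α : MSeries F B)
    (γ : MSeries E F) : comp (incl F ι α) γ = incl E ι (comp α γ) := comp_map _ _ _

theorem IsCondExp.map_incl_mul (hφ : IsCondExp ι φ) (α : MSeries E B) (β : MSeries E A) :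
    map φ (incl E ι α * β) = α * map φ β := by
  refine ext_ev fun l => ?_
  induction l generalizing α with
  | nil => rw [ev_map, ev_mul_nil, ev_mul_nil, ev_incl, hφ.map_mul_left, ev_map]
  | cons x l ih =>
    have h : φ (ev (head (incl E ι α) x * β) l) = _ := ih (head α x)
    rw [ev_map, ev_mul_cons, ev_mul_cons, map_add, h, ev_incl, hφ.map_mul_left, ev_map]

theorem IsCondExp.map_mul_incl (hφ : IsCondExp ι φ) (α : MSeries E A) (β : MSeries E B) :
    map φ (α * incl E ι β) = map φ α * β := by
  refine ext_ev fun l => ?_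
  induction l generalizing α with
  | nil => rw [ev_map, ev_mul_nil, ev_mul_nil, ev_incl, hφ.map_mul_right, ev_map]
  | cons x l ih =>
    have h : φ (ev (head α x * incl E ι β) l) = _ := ih (head α x)
    rw [ev_map, ev_mul_cons, ev_mul_cons, map_add, h, ev_incl, hφ.map_mul_right, ev_map]
    rfl

theorem IsCondExp.map_incl (hφ : IsCondExp ι φ) (α : MSeries E B) : map φ (incl E ι α) = α :=
  ext_ev fun l => by
    have := hφ.map_mul_left (ev α l) 1
    rwa [mul_one, hφ.map_one, mul_one] at this

theorem IsCondExp.map_series_one (hφ : IsCondExp ι φ) : map φ (1 : MSeries E A) = 1 := by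
  rw [← _root_.map_one (incl E ι), hφ.map_incl]

end Extension

/-! ### Resolvents and the Boolean description of the transforms. -/

section Boolean

variable {A B : Type*} [Ring A] [Algebra ℂ A] [Ring B] [Algebra ℂ B]
  {ι : B →ₐ[ℂ] A} {φ ψ : A →ₗ[ℂ] B}

/-- For a series `X` without constant term, the series `(1 - X x)⁻¹ = 1 + X x + X x X x + ⋯`. -/
def resolvent (ι : B →ₐ[ℂ] A) (X : MSeries B B) (x : A) : MSeries B A :=
  cinv (1 - incl B ι X * const B x)

theorem ev_one_sub_incl_mul_nil {X : MSeries B B} (hX : ev X [] = 0) (Y : MSeries B A) :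
    ev (1 - incl B ι X * Y) [] = 1 := by
  rw [ev_sub, ev_mul_nil, ev_incl, hX, map_zero, zero_mul, sub_zero, ev_one_nil]

theorem mul_resolvent {X : MSeries B B} (hX : ev X [] = 0) (x : A) :
    (1 - incl B ι X * const B x) * resolvent ι X x = 1 :=
  mul_cinv' (ev_one_sub_incl_mul_nil hX _)

theorem resolvent_mul {X : MSeries B B} (hX : ev X [] = 0) (x : A) :
    resolvent ι X x * (1 - incl B ι X * const B x) = 1 :=
  cinv_mul (ev_one_sub_incl_mul_nil hX _)

theorem comp_resolvent {X : MSeries B B} (hX : ev X [] = 0) (x : A) :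
    comp (resolvent ι (ident B) x) X = resolvent ι X x := by
  rw [resolvent, comp_cinv (ev_one_sub_incl_mul_nil ev_ident_nil _), sub_comp, one_comp, mul_comp,
    comp_incl, ident_comp X hX, const_comp]
  rfl

theorem resolvent_eq {X : MSeries B B} (hX : ev X [] = 0) (x : A) :
    resolvent ι X x = 1 + incl B ι X * (const B x * resolvent ι X x) := by
  have h := mul_resolvent (ι := ι) hX x
  rw [sub_mul, one_mul, sub_eq_iff_eq_add, mul_assoc] at h
  exact h

theorem ev_const_mul_resolvent (x : A) (l : List B) :
    ev (const B x * resolvent ι (ident B) x) l = (cumulantWord ι x l).prod := by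
  induction l with
  | nil =>
    rw [resolvent_eq ev_ident_nil, ev_const_mul, ev_add, ev_mul_nil, ev_incl, ev_ident_nil,
      ev_one_nil]
    simp [cumulantWord]
  | cons b l ih =>
    have h : head (incl B ι (ident B)) b = const B (ι b) := by
      change map ι.toLinearMap (head (ident B) b) = _
      rw [head_ident, MSeries.map_const]
      rfl
    rw [resolvent_eq ev_ident_nil, ev_const_mul, ev_add, ev_one_cons, zero_add, ev_mul_cons,
      ev_incl, ev_ident_nil, map_zero, zero_mul, zero_add, h, ev_const_mul, ih,
      cumulantWord_cons, List.prod_cons, mul_assoc]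

theorem ev_mul_ident_concat (α : MSeries B B) (l : List B) (b : B) :
    ev (α * ident B) (l ++ [b]) = ev α l * b := by
  induction l generalizing α with
  | nil =>
    rw [List.nil_append, ev_mul_cons, ev_mul_nil, ev_ident_nil, mul_zero, add_zero]
    rfl
  | cons x l ih =>
    rw [List.cons_append, ev_mul_cons, ih, ev_cons α]
    have : ev (ident B) (x :: (l ++ [b])) = 0 := by cases l <;> rfl
    rw [this, mul_zero, zero_add]

theorem map_resolvent (hφ : IsCondExp ι φ) {X : MSeries B B} (hX : ev X [] = 0) (x : A) :
    map φ (resolvent ι X x) = 1 + X * map φ (const B x * resolvent ι X x) := by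
  conv_lhs => rw [resolvent_eq hX, map_add, hφ.map_series_one, hφ.map_incl_mul]

/-- The relation between the moments of `x` and a cumulant series of `x`. -/
theorem moments_eq_comp_cumulantSeries (hφ : IsCondExp ι φ) (hψ : IsCondExp ι ψ) (x : A)
    {κ : MSeries A B}
    (hκ : compLast κ (headMoments ι ψ) (headMoments ι φ) = moments φ) :
    map φ (const B x * resolvent ι (ident B) x) =
      comp (cumulantSeries ι κ x) (map ψ (resolvent ι (ident B) x) * ident B) *
        map φ (resolvent ι (ident B) x) := by
  refine ext_ev fun l => ?_
  rw [← ev_compLast_cumulantWord (ψ := ψ) hφ x _ _ _ (isRightModular_of_compLast hφ hψ hκ), hκ,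
    ev_moments, ev_map, ev_const_mul_resolvent]
  · intro b l
    rw [map_resolvent hψ ev_ident_nil, add_mul, one_mul, ev_add, mul_assoc, ev_ident_mul_cons]
    -- As `ψ(R) I = I + I ψ(x R) I`, one-letter words see only the first term and longer words only
    -- the second.
    rcases List.eq_nil_or_concat l with rfl | ⟨l, c, rfl⟩
    · rw [ev_mul_ident_nil, mul_zero, add_zero, List.map_nil, List.prod_nil, hψ.map_one, mul_one,
        ev_ident_singleton]
    · rw [List.concat_eq_append, ev_mul_ident_concat, ev_map, ev_const_mul_resolvent,
        ← hψ.map_mul_right]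
      have : ev (ident B) (b :: (l ++ [c])) = 0 := by cases l <;> rfl
      simp [this, cumulantWord, mul_assoc]
  · rw [map_resolvent hφ ev_ident_nil, ev_add, ev_ident_mul_nil, ev_one_nil, add_zero]
  · intro b l
    rw [map_resolvent hφ ev_ident_nil, ev_add, ev_ident_mul_cons, ev_one_cons, zero_add, ev_map,
      ev_const_mul_resolvent]

theorem map_resolvent_eq_cinv (hφ : IsCondExp ι φ) {x : A} {h : MSeries B B}
    (hh : map φ (const B x * resolvent ι (ident B) x) = h * map φ (resolvent ι (ident B) x)) :
    map φ (resolvent ι (ident B) x) = cinv (1 - ident B * h) := by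
  refine eq_cinv_of_mul_eq_one (by rw [ev_sub, ev_ident_mul_nil, ev_one_nil, sub_zero]) ?_
  rw [sub_mul, one_mul, mul_assoc, ← hh]
  nth_rw 1 [map_resolvent hφ ev_ident_nil]
  exact add_sub_cancel_right _ _

theorem ev_K_nil (hψ : IsCondExp ι ψ) (x : A) : ev (K ι ψ x) [] = ψ x := by
  have h := congr_arg (fun α => ev α [x]) (compLast_freeCumulants hψ)
  simp only [ev_moments, ev_compLast_cons, ev_headMoments_singleton hψ] at h
  simpa [K, ev_cumulantSeries, cumulantWord] using h

/-- The free cumulant series, substituted so as to give the Boolean cumulant series. -/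
def boolSeries (ι : B →ₐ[ℂ] A) (ψ : A →ₗ[ℂ] B) (x : A) (k : MSeries B B) : MSeries B B :=
  comp k (map ψ (resolvent ι (ident B) x) * ident B)

/-- With `m = ψ(R)` and `h = K_x ∘ (m I)`, the left side is `m I h`, which equals `m - 1` because `m
= (1 - I h)⁻¹`. -/
theorem ident_mul_K_comp (hψ : IsCondExp ι ψ) (x : A) :
    comp (ident B * K ι ψ x) (map ψ (resolvent ι (ident B) x) * ident B) =
      map ψ (resolvent ι (ident B) x) - 1 := by
  have hm := moments_eq_comp_cumulantSeries hψ hψ x (compLast_freeCumulants hψ)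
  have h := map_resolvent_eq_cinv hψ hm
  rw [ident_comp_mul _ _ (ev_mul_ident_nil _), mul_assoc]
  set m := map ψ (resolvent ι (ident B) x)
  have h1 : m * (1 - ident B * comp (K ι ψ x) (m * ident B)) = 1 := by
    conv_lhs => enter [1]; rw [h]
    exact cinv_mul (by rw [ev_sub, ev_ident_mul_nil, ev_one_nil, sub_zero])
  rw [mul_sub, mul_one, sub_eq_iff_eq_add] at h1
  exact eq_sub_of_add_eq' h1.symm

theorem geomSeries_comp {X Y : MSeries B B} (hX : ev X [] = 0) (h : Y = cinv (1 - X)) :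
    comp (geomSeries B) X = Y - 1 := by
  have h1 : ev (1 - X) [] = 1 := by rw [ev_sub, hX, ev_one_nil, sub_zero]
  rw [geomSeries, ident_comp_mul _ _ hX, comp_cinv (by rw [ev_sub, ev_one_nil, ev_ident_nil,
    sub_zero]), sub_comp, one_comp, ident_comp X hX, ← h]
  have h2 := mul_cinv' h1
  rw [← h, sub_mul, one_mul, sub_eq_iff_eq_add] at h2
  exact eq_sub_of_add_eq' h2.symm

theorem ev_T_nil (hψ : IsCondExp ι ψ) {x : A} (hx : ψ x = 1) : ev (T ι ψ x) [] = 1 := by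
  have hK := (ev_K_nil hψ x).trans hx
  rw [← ev_comp_nil _ (ident B * K ι ψ x), T, compDiv_comp _ _ (ident_mul_coeff_one hK), hK]

theorem ev_Sig_nil (hψ : IsCondExp ι ψ) {x : A} (hx : ψ x = 1) : ev (Sig ι ψ x) [] = 1 := by
  rw [Sig, ev_comp_nil, ev_cinv_nil (ev_T_nil hψ hx)]

/-- The `H`-transform is the series of Boolean cumulants. -/
theorem H_eq_boolSeries (hψ : IsCondExp ι ψ) {x : A} (hx : ψ x = 1) :
    H ι ψ x = boolSeries ι ψ x (K ι ψ x) := by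
  have hK := (ev_K_nil hψ x).trans hx
  have hm := moments_eq_comp_cumulantSeries hψ hψ x (compLast_freeCumulants hψ)
  have hM := map_resolvent_eq_cinv hψ hm
  change _ = cinv (1 - ident B * boolSeries ι ψ x (K ι ψ x)) at hM
  have h0 : ev (boolSeries ι ψ x (K ι ψ x)) [] = 1 := by rw [boolSeries, ev_comp_nil, hK]
  -- Here `m - 1` plays two roles: it is `(I / (1 - I)) ∘ (I h)` and also `(I K_x) ∘ (m I)`. The
  -- second form makes the defining equation of `T_x` applicable, giving `Σ_x ∘ (I h) = h⁻¹`.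
  have h1 : comp (Sig ι ψ x) (ident B * boolSeries ι ψ x (K ι ψ x)) =
      cinv (boolSeries ι ψ x (K ι ψ x)) := by
    rw [Sig, comp_assoc, geomSeries_comp (ev_ident_mul_nil _) hM, ← ident_mul_K_comp hψ,
      comp_cinv (ev_T_nil hψ hx), ← comp_assoc, T, compDiv_comp _ _ (ident_mul_coeff_one hK)]
    rfl
  -- That is, `λ(Σ_x) ∘ λ(h) = I`, which identifies `h` with the `⋆_λ`-inverse of `Σ_x`.
  have h2 : comp (ident B * Sig ι ψ x) (ident B * boolSeries ι ψ x (K ι ψ x)) = ident B := by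
    rw [ident_comp_mul _ _ (ev_ident_mul_nil _), h1, mul_assoc, mul_cinv' h0, mul_one]
  have h3 := starLambdaInv_comp (ev_Sig_nil hψ hx)
  have h4 := ev_Sig_nil hψ hx
  calc H ι ψ x = comp (comp (H ι ψ x) (ident B * Sig ι ψ x))
        (ident B * boolSeries ι ψ x (K ι ψ x)) := by rw [comp_assoc, h2, comp_ident]
    _ = boolSeries ι ψ x (K ι ψ x) := by
      rw [H, h3, comp_cinv h4, h1]
      exact (eq_cinv_of_mul_eq_one (ev_cinv_nil h0) (cinv_mul h0)).symm

/-- The conditional `H`-transform is the series of Boolean cumulants with respect to `φ`. -/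
theorem Hc_eq_boolSeries (hψ : IsCondExp ι ψ) {x : A} (hx : ψ x = 1) :
    Hc ι φ ψ x = boolSeries ι ψ x (Kc ι φ ψ x) := by
  have hK := (ev_K_nil hψ x).trans hx
  have hm := moments_eq_comp_cumulantSeries hψ hψ x (compLast_freeCumulants hψ)
  have hM := map_resolvent_eq_cinv hψ hm
  change _ = cinv (1 - ident B * boolSeries ι ψ x (K ι ψ x)) at hM
  rw [Hc, actLambda, comp_assoc, H_eq_boolSeries hψ hx, geomSeries_comp (ev_ident_mul_nil _) hM,
    ← ident_mul_K_comp hψ, ← comp_assoc, Tc, compDiv_comp _ _ (ident_mul_coeff_one hK)]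
  rfl

theorem moments_eq_H_mul (hψ : IsCondExp ι ψ) {x : A} (hx : ψ x = 1) :
    map ψ (const B x * resolvent ι (ident B) x) =
      H ι ψ x * map ψ (resolvent ι (ident B) x) := by
  rw [H_eq_boolSeries hψ hx]
  exact moments_eq_comp_cumulantSeries hψ hψ x (compLast_freeCumulants hψ)

theorem moments_eq_Hc_mul (hφ : IsCondExp ι φ) (hψ : IsCondExp ι ψ) {x : A} (hx : ψ x = 1) :
    map φ (const B x * resolvent ι (ident B) x) =
      Hc ι φ ψ x * map φ (resolvent ι (ident B) x) := by
  rw [Hc_eq_boolSeries hψ hx]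
  exact moments_eq_comp_cumulantSeries hφ hψ x (compLast_condCumulants hφ hψ)

/-- Substitution of a series without constant term in the relation between the moments and the
Boolean cumulants. -/
theorem map_const_mul_resolvent_of_eq_mul {x : A} {h : MSeries B B}
    (hh : map φ (const B x * resolvent ι (ident B) x) = h * map φ (resolvent ι (ident B) x))
    {X : MSeries B B} (hX : ev X [] = 0) :
    map φ (const B x * resolvent ι X x) = comp h X * map φ (resolvent ι X x) := by
  have := congr_arg (fun α => comp α X) hh
  simpa only [mul_comp, MSeries.comp_map, const_comp, comp_resolvent hX] using this

end Boolean

/-! ### Conditional freeness for series and their infinite sums. -/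

section Multiplicativity

variable {A B : Type*} [Ring A] [Algebra ℂ A] [Ring B] [Algebra ℂ B]
  {ι : B →ₐ[ℂ] A} {φ ψ : A →ₗ[ℂ] B} {a b : A}

/-- The subring of series with coefficients in a subalgebra. -/
def MSeries.coeffSubring (E : Type*) [AddCommGroup E] [Module ℂ E] (S : Subalgebra ℂ A) :
    Subring (MSeries E A) where
  carrier := {α | ∀ l, ev α l ∈ S}
  mul_mem' := ev_mul_mem S
  one_mem' l := by
    cases l with
    | nil => exact S.one_mem
    | cons x l => exact S.zero_mem
  add_mem' hα hβ l := S.add_mem (hα l) (hβ l)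
  zero_mem' _ := S.zero_mem
  neg_mem' hα l := S.neg_mem (hα l)

theorem IsCondFree.map_prod (h : IsCondFree ι φ ψ a b) (hφ : IsCondExp ι φ)
    (Q : List (Bool × A)) (hchain : (Q.map Prod.fst).IsChain (· ≠ ·))
    (hQ : ∀ s ∈ Q, s.2 ∈ genAlg ι (if s.1 then a else b) ∧ ψ s.2 = 0) :
    φ (Q.map Prod.snd).prod = (Q.map fun s => φ s.2).prod := by
  cases hn : Q.length with
  | zero =>
    rw [List.length_eq_zero_iff] at hn
    simp [hn, hφ.map_one]
  | succ n =>
    have := h.cond n (fun j => (Q[j]).1) (fun j => (Q[j]).2) ⟨fun j => (hQ _ (by simp)).1,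
      fun j => (hQ _ (by simp)).2, fun j => ?_⟩
    · have e1 : (List.ofFn fun j : Fin (n + 1) => (Q[j]).2) = Q.map Prod.snd :=
        List.ext_getElem (by simp [hn]) fun i _ _ => by rw [List.getElem_ofFn, List.getElem_map]; rfl
      have e2 : (List.ofFn fun j : Fin (n + 1) => φ (Q[j]).2) = Q.map fun s => φ s.2 :=
        List.ext_getElem (by simp [hn]) fun i _ _ => by rw [List.getElem_ofFn, List.getElem_map]; rfl
      rwa [e1, e2] at this
    · have := List.isChain_iff_getElem.1 hchain j (by simp; omega)
      simpa using this

/-- A series which is centred and has coefficients in the algebra generated by `B` and `a` (or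
`b`). -/
structure IsCentredSeries (ι : B →ₐ[ℂ] A) (ψ : A →ₗ[ℂ] B) (a b : A) (i : Bool)
    (s : MSeries B A) : Prop where
  mem : s ∈ coeffSubring B (genAlg ι (if i then a else b))
  centred : map ψ s = 0

theorem IsCentredSeries.head {i : Bool} {s : MSeries B A} (h : IsCentredSeries ι ψ a b i s)
    (x : B) : IsCentredSeries ι ψ a b i (head s x) :=
  ⟨fun l => by rw [← ev_cons]; exact h.mem _, by rw [← head_map, h.centred]; rfl⟩

/-- The list `Q` of constants exists for the induction: the first series either contributes its
constant term, which joins `Q`, or absorbs a letter and is replaced by its head, which is again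
centred and of the same colour. -/
theorem IsCondFree.map_prod_mul_ev (h : IsCondFree ι φ ψ a b) (hφ : IsCondExp ι φ)
    (P : List (Bool × MSeries B A)) (Q : List (Bool × A))
    (hchain : (Q.map Prod.fst ++ P.map Prod.fst).IsChain (· ≠ ·))
    (hQ : ∀ s ∈ Q, s.2 ∈ genAlg ι (if s.1 then a else b) ∧ ψ s.2 = 0)
    (hP : ∀ s ∈ P, IsCentredSeries ι ψ a b s.1 s.2) (l : List B) :
    φ ((Q.map Prod.snd).prod * ev (P.map Prod.snd).prod l) =
      (Q.map fun s => φ s.2).prod * ev (P.map fun s => map φ s.2).prod l := by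
  induction P generalizing Q l with
  | nil =>
    cases l with
    | nil =>
      simp only [List.map_nil, List.prod_nil, ev_one_nil, mul_one]
      exact h.map_prod hφ Q (by simpa using hchain) hQ
    | cons x l => simp [ev_one_cons]
  | cons s P ih =>
    obtain ⟨i, s⟩ := s
    have hstep : ∀ (s : MSeries B A) (_ : IsCentredSeries ι ψ a b i s) (l : List B),
        φ ((Q.map Prod.snd).prod * (ev s [] * ev (P.map Prod.snd).prod l)) =
          (Q.map fun s => φ s.2).prod * (φ (ev s []) * ev (P.map fun s => map φ s.2).prod l) := by
      intro s hs l
      have := ih (Q ++ [(i, ev s [])]) (by simpa using hchain) (fun t ht => ?_)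
        (fun t ht => hP t (List.mem_cons_of_mem _ ht)) l
      · simpa [mul_assoc] using this
      · rcases List.mem_append.1 ht with ht | ht
        · exact hQ t ht
        · rw [List.mem_singleton.1 ht]
          exact ⟨hs.mem [], congr_arg (fun α => ev α []) hs.centred⟩
    have hs : IsCentredSeries ι ψ a b i s := hP (i, s) (by simp)
    clear hP
    simp only [List.map_cons, List.prod_cons]
    induction l generalizing s with
    | nil =>
      rw [ev_mul_nil, ev_mul_nil, hstep s hs, ev_map]
    | cons x l ihl =>
      rw [ev_mul_cons, ev_mul_cons, mul_add, map_add, hstep s hs, mul_add,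
        ihl _ (by exact hchain) (hs.head x),
        ev_map, head_map]

/-- `φ(P Y) = φ(P) Y'` for all alternating centred products `P` that can be followed by a factor
of colour `i`. -/
def IsTail (ι : B →ₐ[ℂ] A) (φ ψ : A →ₗ[ℂ] B) (a b : A) (i : Bool) (Y : MSeries B A)
    (Y' : MSeries B B) : Prop :=
  ∀ P : List (Bool × MSeries B A), (P.map Prod.fst ++ [i]).IsChain (· ≠ ·) →
    (∀ s ∈ P, IsCentredSeries ι ψ a b s.1 s.2) →
    map φ ((P.map Prod.snd).prod * Y) = (P.map fun s => map φ s.2).prod * Y'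

theorem IsTail.map_eq {i : Bool} {Y : MSeries B A} {Y' : MSeries B B}
    (h : IsTail ι φ ψ a b i Y Y') : map φ Y = Y' := by
  simpa using h [] (by simp) (by simp)

theorem IsCondFree.isTail_one (h : IsCondFree ι φ ψ a b) (hφ : IsCondExp ι φ) (i : Bool) :
    IsTail ι φ ψ a b i 1 1 := fun P hchain hP => by
  rw [mul_one, mul_one]
  refine ext_ev fun l => ?_
  simpa using h.map_prod_mul_ev hφ P [] (by simpa using hchain.left_of_append) (by simp) hP l

theorem IsTail.add {i : Bool} {Y Z : MSeries B A} {Y' Z' : MSeries B B}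
    (h : IsTail ι φ ψ a b i Y Y') (h' : IsTail ι φ ψ a b i Z Z') :
    IsTail ι φ ψ a b i (Y + Z) (Y' + Z') := fun P hc hP => by
  rw [mul_add, map_add, h P hc hP, h' P hc hP, mul_add]

/-- The new factor is appended to the alternating product on the left, so what follows it must
accept the opposite colour. -/
theorem IsTail.mul {i : Bool} {s : MSeries B A} {Y : MSeries B A} {Y' : MSeries B B}
    (hs : IsCentredSeries ι ψ a b i s) (h : IsTail ι φ ψ a b (!i) Y Y') :
    IsTail ι φ ψ a b i (s * Y) (map φ s * Y') := fun P hc hP => by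
  have := h (P ++ [(i, s)]) ?_ ?_
  · simpa [mul_assoc] using this
  · rw [List.map_append, List.isChain_append]
    refine ⟨hc, by simp, ?_⟩
    simp
  · intro t ht
    rcases List.mem_append.1 ht with ht | ht
    · exact hP t ht
    · rw [List.mem_singleton.1 ht]
      exact hs

/-- Each coefficient of a product with `Y` depends only on the coefficients of `Y` up to the same
degree. -/
theorem IsTail.limit {i : Bool} {Y : MSeries B A} {Y' : MSeries B B} {Z : ℕ → MSeries B A}
    {Z' : ℕ → MSeries B B} (h : ∀ n, IsTail ι φ ψ a b i (Z n) (Z' n))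
    (hZ : ∀ n l, l.length < n → ev (Y - Z n) l = 0)
    (hZ' : ∀ n l, l.length < n → ev (Y' - Z' n) l = 0) : IsTail ι φ ψ a b i Y Y' :=
  fun P hc hP => by
    refine ext_ev fun l => ?_
    have h1 := congr_arg (fun α => ev α l) (h (l.length + 1) P hc hP)
    have h2 := mul_eq_zero_ev (hZ (l.length + 1)) (P.map Prod.snd).prod l (by omega)
    have h3 := mul_eq_zero_ev (hZ' (l.length + 1)) (P.map fun s => map φ s.2).prod l (by omega)
    rw [mul_sub, ev_sub, sub_eq_zero] at h2 h3
    rw [ev_map, h2, h3]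
    exact h1

theorem MSeries.ev_pow_mul_eq_zero {E R : Type*} [AddCommGroup E] [Module ℂ E] [Ring R]
    [Algebra ℂ R] {N : MSeries E R} (hN : ev N [] = 0) (Z : MSeries E R) (n : ℕ) (l : List E)
    (hl : l.length < n) : ev (N ^ n * Z) l = 0 := by
  induction n generalizing l with
  | zero => simp at hl
  | succ n ih =>
    rw [pow_succ', mul_assoc]
    cases l with
    | nil => rw [ev_mul_nil, hN, zero_mul]
    | cons x l =>
      rw [ev_mul_cons, hN, zero_mul, zero_add]
      exact mul_eq_zero_ev ih _ _ (by simpa using hl)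

theorem MSeries.cinv_one_sub_sub_geom_sum {E R : Type*} [AddCommGroup E] [Module ℂ E] [Ring R]
    [Algebra ℂ R] {N : MSeries E R} (hN : ev N [] = 0) (n : ℕ) :
    cinv (1 - N) - ∑ k ∈ Finset.range n, N ^ k = N ^ n * cinv (1 - N) := by
  have h := geom_sum_mul_neg N n
  have h1 : (1 - N) * cinv (1 - N) = 1 :=
    mul_cinv' (by rw [ev_sub, hN, ev_one_nil, sub_zero])
  calc _ = cinv (1 - N) - (∑ k ∈ Finset.range n, N ^ k) * ((1 - N) * cinv (1 - N)) := by
        rw [h1, mul_one]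
    _ = _ := by rw [← mul_assoc, h, sub_mul, one_mul, sub_sub_cancel]

/-- Conditional freeness for the resummed products `(1 + q) (1 - p₁ q₁)⁻¹ (1 + p)`. -/
theorem IsCondFree.map_mul_cinv_mul (h : IsCondFree ι φ ψ a b) (hφ : IsCondExp ι φ)
    {p p₁ q q₁ : MSeries B A} (hp : IsCentredSeries ι ψ a b true p)
    (hp₁ : IsCentredSeries ι ψ a b true p₁) (hq : IsCentredSeries ι ψ a b false q)
    (hq₁ : IsCentredSeries ι ψ a b false q₁) (h0 : ev p₁ [] = 0) :
    map φ ((1 + q) * (cinv (1 - p₁ * q₁) * (1 + p))) =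
      (1 + map φ q) * (cinv (1 - map φ p₁ * map φ q₁) * (1 + map φ p)) := by
  have hN : ev (p₁ * q₁) [] = 0 := by rw [ev_mul_nil, h0, zero_mul]
  have hN' : ev (map φ p₁ * map φ q₁) [] = 0 := by
    rw [ev_mul_nil, ev_map, h0, map_zero, zero_mul]
  have hend : IsTail ι φ ψ a b true (1 + p) (1 + map φ p) := by
    have := IsTail.mul hp (h.isTail_one hφ (!true))
    rw [mul_one, mul_one] at this
    exact (h.isTail_one hφ true).add this
  -- Multiplying on the left by `q₁` and then by `p₁` flips the colour twice, so the tails stay of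
  -- colour `true`.
  have hpow : ∀ n, IsTail ι φ ψ a b true ((p₁ * q₁) ^ n * (1 + p))
      ((map φ p₁ * map φ q₁) ^ n * (1 + map φ p)) := fun n => by
    induction n with
    | zero => simpa using hend
    | succ n ih =>
      have := IsTail.mul hp₁ (i := true) (IsTail.mul hq₁ (i := false) ih)
      simpa only [pow_succ', mul_assoc] using this
  have hsum : ∀ n, IsTail ι φ ψ a b true ((∑ k ∈ Finset.range n, (p₁ * q₁) ^ k) * (1 + p))
      ((∑ k ∈ Finset.range n, (map φ p₁ * map φ q₁) ^ k) * (1 + map φ p)) := fun n => by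
    induction n with
    | zero =>
      intro P _ _
      simp
    | succ n ih =>
      rw [Finset.sum_range_succ, Finset.sum_range_succ, add_mul, add_mul]
      exact ih.add (hpow n)
  have hlim : IsTail ι φ ψ a b true (cinv (1 - p₁ * q₁) * (1 + p))
      (cinv (1 - map φ p₁ * map φ q₁) * (1 + map φ p)) := by
    -- The remainder of the geometric sum is `N ^ n (1 - N)⁻¹`; as `N` has no constant term, it
    -- vanishes on words shorter than `n`.
    refine IsTail.limit hsum (fun n l hl => ?_) fun n l hl => ?_
    · rw [← sub_mul, cinv_one_sub_sub_geom_sum hN, mul_assoc, ev_pow_mul_eq_zero hN _ _ _ hl]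
    · rw [← sub_mul, cinv_one_sub_sub_geom_sum hN', mul_assoc, ev_pow_mul_eq_zero hN' _ _ _ hl]
  rw [add_mul, add_mul, one_mul, one_mul, map_add, hlim.map_eq,
    (IsTail.mul hq (i := false) hlim).map_eq]

end Multiplicativity

/-! ### The noncommutative identity behind the product formula. -/

section Factorization

/-- A factorization of the inverse of `1 - I a b`. -/
theorem subordination_factorization {R : Type*} [Ring R] {I a b F G S T D E E' p q W : R}
    (hD : D = 1 - I * G * F) (hDE : D * E = 1) (hED : E * D = 1)
    (hE' : E' * (1 - F * (I * G)) = 1)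
    (hS : S * (1 - F * I * a) = 1)
    (hT : T * (1 - I * G * b) = 1) (hT' : (1 - I * G * b) * T = 1)
    (hp : p = I * (a * S * (1 - F * (I * G)) - G)) (hq : q = (b - F) * T)
    (hW : W * (1 - D * p * (E' * q)) = 1) :
    E * ((1 + I * G * q) * (W * (1 + D * p * F * E))) * (1 - I * (a * b)) = 1 := by
  subst hD hq
  -- This is the inverse of `1 - I a F`, obtained from `S = (1 - F I a)⁻¹` by the usual exchange of
  -- factors; in terms of it, `p = Ra I (a - G)`.
  obtain ⟨Ra, hRa⟩ : ∃ Ra, Ra = 1 + I * a * S * F := ⟨_, rfl⟩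
  have hRa1 : Ra * (I * a) = I * a * S := by
    linear_combination (norm := (rw [hRa]; noncomm_ring)) -(I * a) * hS
  have hRa2 : Ra * (1 - I * a * F) = 1 := by
    linear_combination (norm := (rw [hRa]; noncomm_ring)) -hRa1 * F
  have hpa : p = Ra * (I * (a - G)) := by
    linear_combination (norm := (rw [hp, hRa]; noncomm_ring)) (I * a) * hS
  have hEE : E' = 1 + F * E * (I * G) := by
    linear_combination (norm := noncomm_ring)
      hE' * (1 + F * E * (I * G)) - E' * F * hDE * (I * G)
  have h1 : E * (1 + I * G * ((b - F) * T)) = T := by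
    linear_combination (norm := noncomm_ring) hED * T - E * hT'
  have h2 : 1 + (1 - I * G * F) * p * F * E = (1 - I * G * F) * Ra := by
    linear_combination (norm := (rw [hp, hRa]; noncomm_ring))
      (1 - I * G * F) * (1 + I * a * S * F) * hDE - hDE
  -- The heart of the identity: `1 - I a b` expanded around `a = G`, `b = F`. Multiplying by `Ra` on
  -- the left and extracting `1 - I G b` on the right turns the second term into `p E' q`.
  have h3 : 1 - I * (a * b) =
      (1 - I * a * F) * E * (1 - I * G * b) - I * (a - G) * E' * (b - F) := by
    linear_combination (norm := (rw [hEE]; noncomm_ring))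
      -(hDE * (1 - I * G * F)) + hDE * (I * G * (b - F)) + I * (a - G) * F * hED
  have h4 : Ra * (1 - I * (a * b)) = (E - p * E' * ((b - F) * T)) * (1 - I * G * b) := by
    linear_combination (norm := (rw [h3]; noncomm_ring))
      hRa2 * (E * (1 - I * G * b)) + hpa * (E' * (b - F) * T * (1 - I * G * b)) +
        Ra * I * (a - G) * E' * (b - F) * hT
  have h5 : (1 - I * G * F) * (E - p * E' * ((b - F) * T)) =
      1 - (1 - I * G * F) * p * (E' * ((b - F) * T)) := by
    rw [mul_sub, hDE]
    simp only [mul_assoc]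
  -- The left factor collapses to `T` and the right one to `D Ra`; then `D (E - p E' q) = 1 - D p E'
  -- q` cancels against `W`, leaving `T (1 - I G b) = 1`.
  calc _ = E * (1 + I * G * ((b - F) * T)) * (W * ((1 + (1 - I * G * F) * p * F * E) *
        (1 - I * (a * b)))) := by simp only [mul_assoc]
    _ = T * (W * ((1 - I * G * F) * (E - p * E' * ((b - F) * T))) * (1 - I * G * b)) := by
      rw [h1, h2, mul_assoc _ Ra, h4]
      simp only [mul_assoc]
    _ = 1 := by rw [h5, hW, one_mul, hT]

end Factorization

/-! ### The product formula. -/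

section Main

variable {A B : Type*} [Ring A] [Algebra ℂ A] [Ring B] [Algebra ℂ B]
  {ι : B →ₐ[ℂ] A} {φ ψ : A →ₗ[ℂ] B} {a b : A}

/-- Expand `ψ((a - 1)(b - 1)) = 0`. This normalization lets the Boolean description of the
transforms apply to `ab`. -/
theorem IsFree.map_mul_eq_one (h : IsFree ι ψ a b) (hψ : IsCondExp ι ψ) (ha : ψ a = 1)
    (hb : ψ b = 1) : ψ (a * b) = 1 := by
  have hmem : ∀ x : A, x - 1 ∈ genAlg ι x := fun x =>
    (genAlg ι x).sub_mem (Algebra.subset_adjoin (by simp)) (genAlg ι x).one_mem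
  have := h 1 ![true, false] ![a - 1, b - 1] ⟨fun j => ?_, fun j => ?_, fun j => ?_⟩
  · have e : (a - 1) * (b - 1) = a * b - a - b + 1 := by noncomm_ring
    simp only [List.ofFn_succ, List.ofFn_zero, List.prod_cons, List.prod_nil, mul_one,
      Matrix.cons_val_zero, Matrix.cons_val_succ, e, map_add, map_sub, ha, hb, hψ.map_one] at this
    simpa [sub_eq_zero] using this
  · fin_cases j
    · exact hmem a
    · exact hmem b
  · fin_cases j
    · simp [ha, hψ.map_one]
    · simp [hb, hψ.map_one]
  · fin_cases j
    simp

theorem const_mul_const (x y : A) : const B x * const B y = const B (x * y) :=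
  ext_ev fun l => by
    rw [ev_const_mul]
    cases l with
    | nil => rfl
    | cons b l => rw [ev_const_cons, ev_const_cons, mul_zero]

theorem const_mem_coeffSubring {S : Subalgebra ℂ A} {x : A} (hx : x ∈ S) :
    const B x ∈ coeffSubring B S := fun l => by
  cases l with
  | nil => exact hx
  | cons b l => exact S.zero_mem

theorem incl_mem_coeffSubring (x : A) (α : MSeries B B) :
    incl B ι α ∈ coeffSubring B (genAlg ι x) := fun l =>
  Algebra.subset_adjoin (Or.inl ⟨ev α l, rfl⟩)

theorem const_self_mem_coeffSubring (ι : B →ₐ[ℂ] A) (x : A) :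
    const B x ∈ coeffSubring B (genAlg ι x) :=
  const_mem_coeffSubring (Algebra.subset_adjoin (by simp))

theorem resolvent_mem_coeffSubring (X : MSeries B B) (x : A) :
    resolvent ι X x ∈ coeffSubring B (genAlg ι x) :=
  ev_cinv_mem _ (sub_mem (one_mem _) (mul_mem (incl_mem_coeffSubring x X)
    (const_self_mem_coeffSubring ι x)))

theorem one_sub_mul_map_resolvent (hφ : IsCondExp ι φ) {x : A} {X h : MSeries B B}
    (hX : ev X [] = 0)
    (hh : map φ (const B x * resolvent ι X x) = h * map φ (resolvent ι X x)) :
    (1 - X * h) * map φ (resolvent ι X x) = 1 := by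
  rw [sub_mul, one_mul, mul_assoc, ← hh, map_resolvent hφ hX]
  exact add_sub_cancel_right _ _

theorem map_resolvent_mul_one_sub (hφ : IsCondExp ι φ) {x : A} {X h : MSeries B B}
    (hX : ev X [] = 0)
    (hh : map φ (const B x * resolvent ι X x) = h * map φ (resolvent ι X x)) :
    map φ (resolvent ι X x) * (1 - X * h) = 1 := by
  have h0 : ev (1 - X * h) [] = 1 := by
    rw [ev_sub, ev_mul_nil, hX, zero_mul, sub_zero, ev_one_nil]
  rw [eq_cinv_of_mul_eq_one h0 (one_sub_mul_map_resolvent hφ hX hh), cinv_mul h0]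

/-- The Boolean cumulant series of `a b`, for `a` and `b` conditionally free, with respect to `φ`,
in terms of series `F`, `G` solving the subordination equations. -/
theorem IsCondFree.Hc_mul (h : IsCondFree ι φ ψ a b) (hφ : IsCondExp ι φ) (hψ : IsCondExp ι ψ)
    (ha : ψ a = 1) (hb : ψ b = 1) {F G : MSeries B B}
    (hF : actLambda (H ι ψ b) G = F) (hG : actRho (H ι ψ a) F = G) :
    Hc ι φ ψ (a * b) = actRho (Hc ι φ ψ a) F * actLambda (Hc ι φ ψ b) G := by
  have hX : ev (F * ident B) [] = 0 := ev_mul_ident_nil _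
  have hY : ev (ident B * G) [] = 0 := ev_ident_mul_nil _
  have hψa := map_const_mul_resolvent_of_eq_mul (moments_eq_H_mul hψ ha) hX
  have hψb := map_const_mul_resolvent_of_eq_mul (moments_eq_H_mul hψ hb) hY
  have hφa := map_const_mul_resolvent_of_eq_mul (moments_eq_Hc_mul hφ hψ ha) hX
  have hφb := map_const_mul_resolvent_of_eq_mul (moments_eq_Hc_mul hφ hψ hb) hY
  have hab := map_resolvent_eq_cinv hφ (moments_eq_Hc_mul hφ hψ (h.free.map_mul_eq_one hψ ha hb))
  change _ = actRho (H ι ψ a) F * _ at hψa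
  change _ = actLambda (H ι ψ b) G * _ at hψb
  change _ = actRho (Hc ι φ ψ a) F * _ at hφa
  change _ = actLambda (Hc ι φ ψ b) G * _ at hφb
  rw [hG] at hψa
  rw [hF] at hψb
  generalize actRho (Hc ι φ ψ a) F = Gc at hφa ⊢
  generalize actLambda (Hc ι φ ψ b) G = Fc at hφb ⊢
  generalize Hc ι φ ψ (a * b) = Hab at hab ⊢
  have hψa' := map_resolvent_mul_one_sub hψ hX hψa
  have hφa' := map_resolvent_mul_one_sub hφ hX hφa
  have hφb' := map_resolvent_mul_one_sub hφ hY hφb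
  have hφb'' := one_sub_mul_map_resolvent hφ hY hφb
  have hD0 : ev (1 - ident B * G * F) [] = 1 := by
    rw [ev_sub, mul_assoc, ev_ident_mul_nil, sub_zero, ev_one_nil]
  have hD0' : ev (1 - F * (ident B * G)) [] = 1 := by
    rw [ev_sub, ← mul_assoc, ev_mul_nil, hX, zero_mul, sub_zero, ev_one_nil]
  have hDE := mul_cinv' hD0
  have hED := cinv_mul hD0
  have hE' := cinv_mul hD0'
  generalize cinv (1 - ident B * G * F) = E at hDE hED
  obtain ⟨D, hD⟩ : ∃ D, D = 1 - ident B * G * F := ⟨_, rfl⟩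
  rw [← hD] at hDE hED
  generalize cinv (1 - F * (ident B * G)) = E' at hE'
  set S := resolvent ι (F * ident B) a
  set T := resolvent ι (ident B * G) b
  -- the centred series
  obtain ⟨p, hp⟩ : ∃ p, p = incl B ι (ident B) *
    (const B a * S * (1 - incl B ι F * (incl B ι (ident B) * incl B ι G)) - incl B ι G) := ⟨_, rfl⟩
  obtain ⟨q, hq⟩ : ∃ q, q = (const B b - incl B ι F) * T := ⟨_, rfl⟩
  -- Stated for a general expectation `χ`: with `χ = ψ` it shows that `p` is centred, with `χ = φ`
  -- it puts `φ(p)` in the form needed to reuse the factorization over `B`.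
  have hmapp : ∀ {χ : A →ₗ[ℂ] B} (_ : IsCondExp ι χ) {g : MSeries B B}
      (_ : map χ (const B a * S) = g * map χ S),
      map χ p = ident B * (g * map χ S * (1 - F * (ident B * G)) - G) := by
    intro χ hχ g hg
    have e : (1 - incl B ι F * (incl B ι (ident B) * incl B ι G)) =
        incl B ι (1 - F * (ident B * G)) := by simp only [map_sub, _root_.map_one, map_mul]
    rw [hp, e, hχ.map_incl_mul, map_sub, hχ.map_mul_incl, hg, hχ.map_incl]
  have hmapq : ∀ {χ : A →ₗ[ℂ] B} (_ : IsCondExp ι χ) {f : MSeries B B}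
      (_ : map χ (const B b * T) = f * map χ T), map χ q = (f - F) * map χ T := by
    intro χ hχ f hf
    rw [hq, sub_mul, map_sub, hχ.map_incl_mul, hf, sub_mul]
  -- The subordination equation `G = H_a ·_ρ F` enters here: it gives `ψ(a S) = G ψ(S)` and `ψ(S) =
  -- (1 - F I G)⁻¹`.
  have hψp : map ψ p = 0 := by
    rw [hmapp hψ hψa, mul_assoc G, ← mul_assoc F, hψa', mul_one, sub_self, mul_zero]
  have hψq : map ψ q = 0 := by rw [hmapq hψ hψb, sub_self, zero_mul]
  have hpm : p ∈ coeffSubring B (genAlg ι a) := by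
    rw [hp]
    exact mul_mem (incl_mem_coeffSubring _ _) (sub_mem (mul_mem (mul_mem
      (const_self_mem_coeffSubring _ _) (resolvent_mem_coeffSubring _ _)) (sub_mem (one_mem _)
      (mul_mem (incl_mem_coeffSubring _ _) (mul_mem (incl_mem_coeffSubring _ _)
      (incl_mem_coeffSubring _ _))))) (incl_mem_coeffSubring _ _))
  have hqm : q ∈ coeffSubring B (genAlg ι b) := by
    rw [hq]
    exact mul_mem (sub_mem (const_self_mem_coeffSubring _ _) (incl_mem_coeffSubring _ _))
      (resolvent_mem_coeffSubring _ _)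
  have hp0 : ev p [] = 0 := by
    rw [hp, ev_mul_nil, ev_incl, ev_ident_nil, map_zero, zero_mul]
  have hp1 : IsCentredSeries ι ψ a b true (incl B ι D * p) :=
    ⟨mul_mem (incl_mem_coeffSubring _ _) hpm, by rw [hψ.map_incl_mul, hψp, mul_zero]⟩
  have hp2 : IsCentredSeries ι ψ a b true (incl B ι D * p * incl B ι F * incl B ι E) :=
    ⟨mul_mem (mul_mem hp1.mem (incl_mem_coeffSubring _ _)) (incl_mem_coeffSubring _ _), by
      rw [hψ.map_mul_incl, hψ.map_mul_incl, hp1.centred, zero_mul, zero_mul]⟩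
  have hq1 : IsCentredSeries ι ψ a b false (incl B ι (ident B) * incl B ι G * q) :=
    ⟨mul_mem (mul_mem (incl_mem_coeffSubring _ _) (incl_mem_coeffSubring _ _)) hqm, by
      rw [← map_mul, hψ.map_incl_mul, hψq, mul_zero]⟩
  have hq2 : IsCentredSeries ι ψ a b false (incl B ι E' * q) :=
    ⟨mul_mem (incl_mem_coeffSubring _ _) hqm, by rw [hψ.map_incl_mul, hψq, mul_zero]⟩
  have hp10 : ev (incl B ι D * p) [] = 0 := by rw [ev_mul_nil, hp0, mul_zero]
  have hmul := h.map_mul_cinv_mul hφ hp2 hp1 hq1 hq2 hp10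
  -- the factorization in the algebra of series over `A`
  have hfac := subordination_factorization (R := MSeries B A) (I := incl B ι (ident B))
    (a := const B a) (b := const B b) (F := incl B ι F) (G := incl B ι G) (S := S) (T := T)
    (D := incl B ι D) (E := incl B ι E) (E' := incl B ι E') (p := p) (q := q)
    (W := cinv (1 - incl B ι D * p * (incl B ι E' * q)))
    (by rw [hD, map_sub, _root_.map_one, map_mul, map_mul])
    (by rw [← map_mul, hDE, _root_.map_one]) (by rw [← map_mul, hED, _root_.map_one])
    (by
      have := congr_arg (incl B ι) hE'
      simpa only [map_sub, _root_.map_one, map_mul] using this)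
    (by rw [← map_mul]; exact resolvent_mul hX a)
    (by rw [← map_mul]; exact resolvent_mul hY b)
    (by rw [← map_mul]; exact mul_resolvent hY b) hp hq
    (cinv_mul (by rw [ev_sub, ev_mul_nil, hp10, zero_mul, sub_zero, ev_one_nil]))
  rw [const_mul_const] at hfac
  have hleft := left_inv_eq_right_inv hfac (mul_resolvent (ι := ι) ev_ident_nil (a * b))
  -- the factorization in the algebra of series over `B`
  have hp10' : ev (D * map φ p) [] = 0 := by rw [ev_mul_nil, ev_map, hp0, map_zero, mul_zero]
  have hfac' := subordination_factorization (R := MSeries B B) (I := ident B)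
    (a := Gc) (b := Fc) (F := F) (G := G) (S := map φ S) (T := map φ T)
    (D := D) (E := E) (E' := E') (p := map φ p) (q := map φ q)
    (W := cinv (1 - D * map φ p * (E' * map φ q))) hD hDE hED hE' hφa' hφb' hφb''
    (hmapp hφ hφa) (hmapq hφ hφb)
    (cinv_mul (by rw [ev_sub, ev_mul_nil, hp10', zero_mul, sub_zero, ev_one_nil]))
  -- Apply `φ` to the factorized `(1 - I a b)⁻¹`: bimodularity handles the series over `B`, and
  -- conditional freeness replaces `p`, `q` by their images.
  have hres : map φ (resolvent ι (ident B) (a * b)) =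
      E * ((1 + ident B * G * map φ q) *
        (cinv (1 - D * map φ p * (E' * map φ q)) * (1 + D * map φ p * F * E))) := by
    rw [← hleft, hφ.map_incl_mul, hmul, hφ.map_mul_incl, hφ.map_mul_incl, hφ.map_incl_mul,
      hφ.map_incl_mul, ← map_mul, hφ.map_incl_mul]
  rw [← hres, hab] at hfac'
  have h1 : ev (1 - ident B * Hab) [] = 1 := by
    rw [ev_sub, ev_ident_mul_nil, sub_zero, ev_one_nil]
  have h2 := left_inv_eq_right_inv (mul_cinv' h1) hfac'
  exact ident_mul_cancel (sub_right_injective h2)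

end Main

end CondFree

end

theorem mainTheorem4 {A B : Type*} [Ring A] [Algebra ℂ A] [Ring B] [Algebra ℂ B]
    (ι : B →ₐ[ℂ] A) (φ ψ : A →ₗ[ℂ] B)
    (hφ : CondFree.IsCondExp ι φ) (hψ : CondFree.IsCondExp ι ψ)
    (a b : A) (hab : CondFree.IsCondFree ι φ ψ a b)
    (hφa : φ a = 1) (hφb : φ b = 1) (hψa : ψ a = 1) (hψb : ψ b = 1) :
    CondFree.Hc ι φ ψ (a * b) =
        CondFree.actRho (CondFree.Hc ι φ ψ a) (CondFree.HleftTack ι ψ a b) *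
          CondFree.actLambda (CondFree.Hc ι φ ψ b) (CondFree.HrightTack ι ψ a b) ∧
      CondFree.HleftTack ι ψ a b =
        CondFree.actLambda (CondFree.H ι ψ b)
          (CondFree.actRho (CondFree.H ι ψ a) (CondFree.HleftTack ι ψ a b)) ∧
      CondFree.HrightTack ι ψ a b =
        CondFree.actRho (CondFree.H ι ψ a)
          (CondFree.actLambda (CondFree.H ι ψ b) (CondFree.HrightTack ι ψ a b)) := by
  -- Take `f = Σ_a` and let `h` be the `⋆_λ`-inverse of `Σ_b`, which is `H_b`. Both subordination
  -- equations follow from this one and the definition of `H_{a⊣b}`.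
  have hG : CondFree.actRho (CondFree.H ι ψ a) (CondFree.HleftTack ι ψ a b) =
      CondFree.HrightTack ι ψ a b :=
    CondFree.actRho_starLambdaInv (CondFree.ev_Sig_nil hψ hψa)
      (CondFree.ev_starLambdaInv_nil (CondFree.ev_Sig_nil hψ hψb))
  refine ⟨hab.Hc_mul hφ hψ hψa hψb rfl hG, ?_, hG.symm⟩
  rw [hG]
  rfl
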